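/- **Programs.** Fix disjoint finite sets $V_p$ (program variables) and $V_r$ (sampling variables), all integer-valued; every $r\in V_r$ carries a discrete distribution $\Upsilon(r)$ on $\mathbb Z$, and $\overline\Upsilon$ is the joint (product) distribution on $\mathrm{Val}_{V_r}=\mathbb Z^{V_r}$. Programs are built by $$P ::= \textbf{skip}\mid x:=\mathfrak e\mid P;P\mid \textbf{if }G\textbf{ then }P\textbf{ else }P\textbf{ fi}\mid \textbf{if }\star\textbf{ then }P\textbf{ else }P\textbf{ fi}\mid\textbf{if prob}(p)\textbf{ then }P\textbf{ else }P\textbf{ fi}\mid\textbf{while }G\textbf{ do }P\textbf{ od},$$ where $\mathfrak e$ is an arithmetic expression over $V_p\cup V_r$ (with an arbitrary choice of operations), $G$ is a propositional combination of comparisons of arithmetic expressions over $V_p$, and $p\in[0,1]$. The control flow graph of $P$ has one label for each assignment, skip, branch and loop, and a terminal label $\ell_{out}$; $\ell_{in}$ is the initial label. Configurations are pairs $(\ell,\nu)$ with $\nu\in\mathrm{Val}_{V_p}=\mathbb Z^{V_p}$. An assignment label with update function $u$ and target $\ell'$ leads from $(\ell,\nu)$ to $(\ell',u(\nu,\mu))$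 with $\mu\sim\overline\Upsilon$ sampled afresh (skip is the identity update); conditional and loop labels test the guard; probabilistic labels take the then-branch with probability $p$; at nondeterministic labels a scheduler, which maps each history of configurations to a distribution over the available actions, chooses the branch; $\ell_{out}$ is absorbing. $\textsc{Tm}(P)$ means: for every initial valuation $\nu$ and every scheduler, the run started at $(\ell_{in},\nu)$ reaches $\ell_{out}$ with probability $1$. **DSM-maps.** An invariant $I$ of $P$ assigns to each label $\ell$ a set $I(\ell)$ of valuations containing all $\nu$ such that $(\ell,\nu)$ is reachable from some $(\ell_{in},\nu_0)$ by steps of positive probability. A *partial DSM* of $P$ w.r.t. $\varepsilon>0$, $a\le b$ and $I$ is a function $\eta(\ell,\nu)\in\mathbb R$ such that for every label $\ell$ and all $\nu\in I(\ell)$: (D1) at an assignment label with update $u$ and target $\ell'$: $a\le\eta(\ell',u(\nu,\mu))-\eta(\ell,\nu)\le b$ for all $\mu$ with $\overline\Upsilon(\mu)>0$, and $\sum_\mu\overline\Upsilon(\mu)\,\eta(\ell',u(\nu,\mu))\le\eta(\ell,\nu)-\varepsilon$; (D2) at a conditional or loop label: $a\le\eta(\ell',\nu)-\eta(\ell,\nu)\le\min\{-\varepsilon,b\}$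 for the successor $\ell'$ selected by the guard at $\nu$; (D3) at a nondeterministic label: the same for both successors $\ell'$; (D4) at a probabilistic label with successors $\ell',\ell''$: $a\le\eta(\ell',\nu)-\eta(\ell,\nu)\le b$, $a\le\eta(\ell'',\nu)-\eta(\ell,\nu)\le b$ and $p\,\eta(\ell',\nu)+(1-p)\,\eta(\ell'',\nu)\le\eta(\ell,\nu)-\varepsilon$. It is a *DSM-map* (w.r.t. additionally $c\in\mathbb R$) if moreover (D5) $\eta(\ell,\nu)\ge c$ whenever $\ell$ is the label of an outermost loop with guard $G$ and $\nu\in I(\ell)$, $\nu\models G$. (For $P=\textbf{while }G\textbf{ do }P'\textbf{ od}$ this only concerns $\ell=\ell_{in}$.) **Triples.** For real-valued arithmetic expressions $R,R'$ over $V_p$, the triple $\{R\}P\{R'\}$ (resp. $\langle R\rangle P\langle R'\rangle$) means that, for some parameters and some invariant, $P$ has a DSM-map (resp. a partial DSM) $\eta$ with $\eta(\ell_{in},\cdot)=R$ and $\eta(\ell_{out},\cdot)=R'$. **The proof system $\mathcal D$.** In each application of a rule, $a,b,c\in\mathbb R$ and $\varepsilon>0$ are arbitrary, and inequalities are required for all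 valuations in $\mathrm{Val}_{V_p}$. Rules (2)–(7) are stated for $\{\cdot\}\cdot\{\cdot\}$; each also has the version with $\langle\cdot\rangle\cdot\langle\cdot\rangle$ in all of its triples. 1. From $\langle R\rangle P\langle R'\rangle$, $G\to a\le R-R'\le-\varepsilon$ and $\neg G\to a\le R''-R'\le-\varepsilon$ infer $\langle R'\rangle\,\textbf{while }G\textbf{ do }P\textbf{ od}\,\langle R''\rangle$; if in addition $G\to R'\ge c$, infer $\{R'\}\,\textbf{while }G\textbf{ do }P\textbf{ od}\,\{R''\}$. 2. From $a\le R'-R\le-\varepsilon$ infer $\{R\}\,\textbf{skip}\,\{R'\}$. 3. From $a\le R'[x\leftarrow\mathfrak e]-R\le b$ (for all values of the sampling variables of positive probability) and $\mathbb E[R'[x\leftarrow\mathfrak e]]-R\le-\varepsilon$ (expectation over the sampling variables) infer $\{R\}\,x:=\mathfrak e\,\{R'\}$. 4. From $\{R\}P_1\{R'\}$ and $\{R'\}P_2\{R''\}$ infer $\{R\}P_1;P_2\{R''\}$. 5. From $\{R_1\}P_1\{R'\}$, $\{R_2\}P_2\{R'\}$, $G\to a\le R_1-R\le-\varepsilon$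 and $\neg G\to a\le R_2-R\le-\varepsilon$ infer $\{R\}\,\textbf{if }G\textbf{ then }P_1\textbf{ else }P_2\textbf{ fi}\,\{R'\}$. 6. From $\{R_1\}P_1\{R'\}$, $\{R_2\}P_2\{R'\}$, $a\le R_1-R\le-\varepsilon$ and $a\le R_2-R\le-\varepsilon$ infer $\{R\}\,\textbf{if }\star\textbf{ then }P_1\textbf{ else }P_2\textbf{ fi}\,\{R'\}$. 7. From $\{R_1\}P_1\{R'\}$, $\{R_2\}P_2\{R'\}$, $a\le R_1-R\le b$, $a\le R_2-R\le b$ and $pR_1+(1-p)R_2\le R-\varepsilon$ infer $\{R\}\,\textbf{if prob}(p)\textbf{ then }P_1\textbf{ else }P_2\textbf{ fi}\,\{R'\}$. 8. From $\textsc{Tm}(P)$ and $\{R_1\}\,\textbf{while }G\textbf{ do }P\textbf{ od}\,\{R_2\}$ infer $\textsc{Tm}(\textbf{while }G\textbf{ do }P\textbf{ od})$. 9. Infer $\textsc{Tm}(x:=\mathfrak e)$ and $\textsc{Tm}(\textbf{skip})$. 10. From $\textsc{Tm}(P_1)$ and $\textsc{Tm}(P_2)$ infer $\textsc{Tm}(P_1;P_2)$.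 11. From $\textsc{Tm}(P_1)$ and $\textsc{Tm}(P_2)$ infer $\textsc{Tm}$ of the conditional, the nondeterministic and the probabilistic branching of $P_1$ and $P_2$. **Theorem.** $\mathcal D$ is sound for almost-sure termination: for every rule, if its premises hold (with the meaning of triples and of $\textsc{Tm}$ given above), then its conclusion holds. Consequently every derivable judgment holds; in particular, if $\textsc{Tm}(P)$ is derivable in $\mathcal D$, then $P$ terminates almost surely for every initial valuation under every scheduler. -/

import Mathlib

open MeasureTheory ProbabilityTheory
open scoped ENNReal

namespace DSM

/-! ### Expressions, predicates and programs -/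

/-- A choice of arithmetic operations: arbitrary operations on the integers (used in programs and
predicates), and arbitrary operations on the reals (used in the expressions of Hoare triples). -/
structure Ops where
  IntOp : Type
  intArity : IntOp → ℕ
  intInterp : (o : IntOp) → (Fin (intArity o) → ℤ) → ℤ
  RealOp : Type
  realArity : RealOp → ℕ
  realInterp : (o : RealOp) → (Fin (realArity o) → ℝ) → ℝ

/-- Valuations: every variable is integer-valued. -/
abbrev Val (V : Type) : Type := V → ℤ

/-- Integer arithmetic expressions over the variables `V`. -/
inductive Expr (S : Ops) (V : Type) : Type
  | const (k : ℤ)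
  | var (x : V)
  | op (o : S.IntOp) (args : Fin (S.intArity o) → Expr S V)

/-- The value of an integer arithmetic expression. -/
def Expr.eval {S : Ops} {V : Type} (ν : Val V) : Expr S V → ℤ
  | .const k => k
  | .var x => ν x
  | .op o args => S.intInterp o (fun i => (args i).eval ν)

/-- Simultaneous substitution of expressions for variables. -/
def Expr.bind {S : Ops} {V W : Type} (f : V → Expr S W) : Expr S V → Expr S W
  | .const k => .const k
  | .var x => f x
  | .op o args => .op o (fun i => (args i).bind f)

/-- Real-valued arithmetic expressions over the (integer) variables `V`. -/
inductive RExpr (S : Ops) (V : Type) : Type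
  | const (r : ℝ)
  | int (e : Expr S V)
  | op (o : S.RealOp) (args : Fin (S.realArity o) → RExpr S V)

/-- The value of a real-valued arithmetic expression. -/
noncomputable def RExpr.eval {S : Ops} {V : Type} (ν : Val V) : RExpr S V → ℝ
  | .const r => r
  | .int e => (e.eval ν : ℝ)
  | .op o args => S.realInterp o (fun i => (args i).eval ν)

/-- Simultaneous substitution of integer expressions for variables. -/
def RExpr.bind {S : Ops} {V W : Type} (f : V → Expr S W) : RExpr S V → RExpr S W
  | .const r => .const r
  | .int e => .int (e.bind f)
  | .op o args => .op o (fun i => (args i).bind f)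

/-- Comparison symbols. -/
inductive Cmp : Type
  | lt | le | gt | ge

/-- The relation on the integers denoted by a comparison symbol. -/
def Cmp.Holds : Cmp → ℤ → ℤ → Prop
  | .lt, m, n => m < n
  | .le, m, n => m ≤ n
  | .gt, m, n => m > n
  | .ge, m, n => m ≥ n

/-- Propositional arithmetic predicates over the variables `V`. -/
inductive BExpr (S : Ops) (V : Type) : Type
  | atom (c : Cmp) (e e' : Expr S V)
  | not (φ : BExpr S V)
  | or (φ ψ : BExpr S V)
  | and (φ ψ : BExpr S V)

/-- The satisfaction relation `ν ⊨ φ`. -/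
def BExpr.Sat {S : Ops} {V : Type} (ν : Val V) : BExpr S V → Prop
  | .atom c e e' => c.Holds (e.eval ν) (e'.eval ν)
  | .not φ => ¬ φ.Sat ν
  | .or φ ψ => φ.Sat ν ∨ ψ.Sat ν
  | .and φ ψ => φ.Sat ν ∧ ψ.Sat ν

/-- Probabilistic programs over the program variables `Vp` and the sampling variables `Vr`. -/
inductive Prog (S : Ops) (Vp Vr : Type) : Type
  | skip
  | assign (x : Vp) (e : Expr S (Vp ⊕ Vr))
  | seq (P Q : Prog S Vp Vr)
  | ite (G : BExpr S Vp) (P Q : Prog S Vp Vr)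
  | nondet (P Q : Prog S Vp Vr)
  | prob (p : unitInterval) (P Q : Prog S Vp Vr)
  | while (G : BExpr S Vp) (P : Prog S Vp Vr)

/-! ### The control flow graph of a program -/

/-- The label kinds of a control flow graph, each with its outgoing transitions:
assignment labels carry an update function; conditional labels have the transitions
`φ` and `¬ φ`; probabilistic labels have the transitions `p` and `1 - p`; nondeterministic
labels have the transitions of the then-branch and the else-branch. -/
inductive Node (S : Ops) (Vp Vr L : Type) : Type
  | assign (u : Val Vp → Val Vr → Val Vp) (l : L)
  | cond (φ : BExpr S Vp) (l₁ l₂ : L)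
  | prob (p : unitInterval) (l₁ l₂ : L)
  | nondet (l₁ l₂ : L)

/-- Renaming of target labels. -/
def Node.map {S : Ops} {Vp Vr L L' : Type} (f : L → L') : Node S Vp Vr L → Node S Vp Vr L'
  | .assign u l => .assign u (f l)
  | .cond φ l₁ l₂ => .cond φ (f l₁) (f l₂)
  | .prob p l₁ l₂ => .prob p (f l₁) (f l₂)
  | .nondet l₁ l₂ => .nondet (f l₁) (f l₂)

section CFG

variable {S : Ops} {Vp Vr : Type}

/-- The non-terminal labels of a program: one for each assignment, skip, branch and loop. -/
def Prog.Loc : Prog S Vp Vr → Type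
  | .skip => Unit
  | .assign _ _ => Unit
  | .seq P Q => P.Loc ⊕ Q.Loc
  | .ite _ P Q => Option (P.Loc ⊕ Q.Loc)
  | .nondet P Q => Option (P.Loc ⊕ Q.Loc)
  | .prob _ P Q => Option (P.Loc ⊕ Q.Loc)
  | .while _ P => Option P.Loc

/-- All labels of a program; `none` is the terminal label. -/
abbrev Prog.Label (P : Prog S Vp Vr) : Type := Option P.Loc

/-- The initial label, as a non-terminal label. -/
def Prog.entry : (P : Prog S Vp Vr) → P.Loc
  | .skip => ()
  | .assign _ _ => ()
  | .seq P _ => Sum.inl P.entry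
  | .ite _ _ _ => none
  | .nondet _ _ => none
  | .prob _ _ _ => none
  | .while _ _ => none

/-- The initial label. -/
def Prog.lin (P : Prog S Vp Vr) : P.Label := some P.entry

/-- The terminal label. -/
def Prog.lout (P : Prog S Vp Vr) : P.Label := none

/-- The transitions of the control flow graph. -/
def Prog.node [DecidableEq Vp] : (P : Prog S Vp Vr) → P.Loc → Node S Vp Vr P.Label
  | .skip, _ => .assign (fun ν _ => ν) none
  | .assign x e, _ =>
      .assign (fun ν μ => Function.update ν x (e.eval (Sum.elim ν μ))) none
  | .seq P Q, l => match l with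
      | Sum.inl l => (P.node l).map fun
          | some l' => some (Sum.inl l')
          | none => some (Sum.inr Q.entry)
      | Sum.inr l => (Q.node l).map (Option.map Sum.inr)
  | .ite G P Q, l => match l with
      | none => .cond G (some (some (Sum.inl P.entry))) (some (some (Sum.inr Q.entry)))
      | some (Sum.inl l) => (P.node l).map (Option.map fun l' => some (Sum.inl l'))
      | some (Sum.inr l) => (Q.node l).map (Option.map fun l' => some (Sum.inr l'))
  | .nondet P Q, l => match l with
      | none => .nondet (some (some (Sum.inl P.entry))) (some (some (Sum.inr Q.entry)))
      | some (Sum.inl l) => (P.node l).map (Option.map fun l' => some (Sum.inl l'))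
      | some (Sum.inr l) => (Q.node l).map (Option.map fun l' => some (Sum.inr l'))
  | .prob p P Q, l => match l with
      | none => .prob p (some (some (Sum.inl P.entry))) (some (some (Sum.inr Q.entry)))
      | some (Sum.inl l) => (P.node l).map (Option.map fun l' => some (Sum.inl l'))
      | some (Sum.inr l) => (Q.node l).map (Option.map fun l' => some (Sum.inr l'))
  | .while G P, l => match l with
      | none => .cond G (some (some P.entry)) none
      | some l => (P.node l).map fun
          | some l' => some (some l')
          | none => some none

/-- The guard of an outermost loop (a loop that is not nested inside another loop), at the label
of that loop; `none` at all other labels. -/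
def Prog.outerGuard : (P : Prog S Vp Vr) → P.Loc → Option (BExpr S Vp)
  | .skip, _ => none
  | .assign _ _, _ => none
  | .seq P Q, l => match l with
      | Sum.inl l => P.outerGuard l
      | Sum.inr l => Q.outerGuard l
  | .ite _ P Q, l => match l with
      | none => none
      | some (Sum.inl l) => P.outerGuard l
      | some (Sum.inr l) => Q.outerGuard l
  | .nondet P Q, l => match l with
      | none => none
      | some (Sum.inl l) => P.outerGuard l
      | some (Sum.inr l) => Q.outerGuard l
  | .prob _ P Q, l => match l with
      | none => none
      | some (Sum.inl l) => P.outerGuard l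
      | some (Sum.inr l) => Q.outerGuard l
  | .while G _, l => match l with
      | none => some G
      | some _ => none

instance Prog.finiteLoc : (P : Prog S Vp Vr) → Finite P.Loc
  | .skip => inferInstanceAs (Finite Unit)
  | .assign _ _ => inferInstanceAs (Finite Unit)
  | .seq P Q =>
      have := Prog.finiteLoc P
      have := Prog.finiteLoc Q
      inferInstanceAs (Finite (P.Loc ⊕ Q.Loc))
  | .ite _ P Q =>
      have := Prog.finiteLoc P
      have := Prog.finiteLoc Q
      inferInstanceAs (Finite (Option (P.Loc ⊕ Q.Loc)))
  | .nondet P Q =>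
      have := Prog.finiteLoc P
      have := Prog.finiteLoc Q
      inferInstanceAs (Finite (Option (P.Loc ⊕ Q.Loc)))
  | .prob _ P Q =>
      have := Prog.finiteLoc P
      have := Prog.finiteLoc Q
      inferInstanceAs (Finite (Option (P.Loc ⊕ Q.Loc)))
  | .while _ P =>
      have := Prog.finiteLoc P
      inferInstanceAs (Finite (Option P.Loc))

end CFG

/-! ### The Markov decision process of a program -/

/-- The joint distribution of independent sampling variables. -/
noncomputable def joint {Vr : Type} [Fintype Vr] (Υ : Vr → PMF ℤ) : PMF (Val Vr) :=
  (Measure.pi fun r => (Υ r).toMeasure).toPMF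

theorem joint_apply {Vr : Type} [Fintype Vr] (Υ : Vr → PMF ℤ) (μ : Val Vr) :
    joint Υ μ = ∏ r, Υ r (μ r) := by
  unfold joint
  rw [Measure.toPMF_apply, Measure.pi_singleton]
  exact Finset.prod_congr rfl fun r _ =>
    PMF.toMeasure_apply_singleton _ _ (measurableSet_singleton _)

/-- The Bernoulli distribution that gives `true` the probability `p`. -/
noncomputable def coin (p : unitInterval) : PMF Bool :=
  PMF.ofFintype (fun b => ENNReal.ofReal (if b then (p : ℝ) else 1 - p)) (by
    have h0 : (0 : ℝ) ≤ p := p.2.1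
    have h1 : (0 : ℝ) ≤ 1 - p := sub_nonneg.2 p.2.2
    simp [← ENNReal.ofReal_add h0 h1])

/-- Configurations: a label and a valuation of the program variables. -/
@[ext] structure Config {S : Ops} {Vp Vr : Type} (P : Prog S Vp Vr) : Type where
  loc : P.Label
  val : Val Vp

/-- The actions: no nondeterminism, then-branch, else-branch. -/
inductive Act : Type
  | tau | th | el

/-- The actions that are available at a configuration. -/
def Config.avail {S : Ops} {Vp Vr : Type} [DecidableEq Vp] {P : Prog S Vp Vr} (c : Config P) :
    Set Act :=
  match c.loc with
  | none => {Act.tau}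
  | some l => match P.node l with
      | .nondet _ _ => {Act.th, Act.el}
      | _ => {Act.tau}

open Classical in
/-- The distribution of the next configuration, under an available action. The value at the
unavailable action `tau` of a nondeterministic label is irrelevant. -/
noncomputable def Config.step {S : Ops} {Vp Vr : Type} [Fintype Vr] [DecidableEq Vp]
    {P : Prog S Vp Vr} (Υ : Vr → PMF ℤ) (c : Config P) (α : Act) : PMF (Config P) :=
  match c.loc with
  | none => PMF.pure c
  | some l => match P.node l with
      | .assign u l' => (joint Υ).map fun μ => ⟨l', u c.val μ⟩
      | .cond φ l₁ l₂ => PMF.pure ⟨if φ.Sat c.val then l₁ else l₂, c.val⟩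
      | .prob p l₁ l₂ => (coin p).map fun h => ⟨if h then l₁ else l₂, c.val⟩
      | .nondet l₁ l₂ => match α with
          | .th => PMF.pure ⟨l₁, c.val⟩
          | .el => PMF.pure ⟨l₂, c.val⟩
          | .tau => PMF.pure c

/-- Histories `c₀, …, cₙ`. -/
abbrev History {S : Ops} {Vp Vr : Type} (P : Prog S Vp Vr) (n : ℕ) : Type :=
  (i : Finset.Iic n) → Config P

/-- The current configuration of a history. -/
def History.last {S : Ops} {Vp Vr : Type} {P : Prog S Vp Vr} {n : ℕ} (h : History P n) :
    Config P :=
  h ⟨n, Finset.mem_Iic.2 le_rfl⟩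

/-- Schedulers: they map every history to a distribution over the actions that are available at
the current configuration. -/
structure Scheduler {S : Ops} {Vp Vr : Type} [DecidableEq Vp] (P : Prog S Vp Vr) : Type where
  choose : (n : ℕ) → History P n → PMF Act
  choose_avail : ∀ n h, (choose n h).support ⊆ h.last.avail

/-- Every set of configurations is measurable. -/
instance Config.measurableSpace {S : Ops} {Vp Vr : Type} (P : Prog S Vp Vr) :
    MeasurableSpace (Config P) := ⊤

instance Config.discreteMeasurableSpace {S : Ops} {Vp Vr : Type} (P : Prog S Vp Vr) :
    DiscreteMeasurableSpace (Config P) := ⟨fun _ => trivial⟩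

instance Config.countable {S : Ops} {Vp Vr : Type} [Finite Vp] (P : Prog S Vp Vr) :
    Countable (Config P) := by
  have h : Function.Injective fun c : Config P => (c.loc, c.val) := by
    rintro ⟨l, v⟩ ⟨l', v'⟩ h
    simpa using h
  exact h.countable

/-- The distribution of the configuration that follows a history. -/
noncomputable def Scheduler.next {S : Ops} {Vp Vr : Type} [Fintype Vr] [DecidableEq Vp]
    {P : Prog S Vp Vr} (Υ : Vr → PMF ℤ) (σ : Scheduler P) (n : ℕ) (h : History P n) :
    PMF (Config P) :=
  (σ.choose n h).bind fun α => h.last.step Υ α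

/-- `Scheduler.next` as a Markov kernel. -/
noncomputable def Scheduler.kernel {S : Ops} {Vp Vr : Type} [Fintype Vp] [Fintype Vr]
    [DecidableEq Vp] {P : Prog S Vp Vr} (Υ : Vr → PMF ℤ) (σ : Scheduler P) (n : ℕ) :
    Kernel (History P n) (Config P) where
  toFun h := (σ.next Υ n h).toMeasure
  measurable' := Measurable.of_discrete

instance Scheduler.isMarkovKernel {S : Ops} {Vp Vr : Type} [Fintype Vp] [Fintype Vr]
    [DecidableEq Vp] {P : Prog S Vp Vr} (Υ : Vr → PMF ℤ) (σ : Scheduler P) (n : ℕ) :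
    IsMarkovKernel (σ.kernel Υ n) :=
  ⟨fun h => PMF.toMeasure.isProbabilityMeasure (σ.next Υ n h)⟩

/-- The probability measure on the runs of a program from an initial configuration `c`, under the
scheduler `σ` (the Ionescu-Tulcea measure of the kernels `Scheduler.kernel`). -/
noncomputable def Scheduler.runMeasure {S : Ops} {Vp Vr : Type} [Fintype Vp] [Fintype Vr]
    [DecidableEq Vp] {P : Prog S Vp Vr} (Υ : Vr → PMF ℤ) (σ : Scheduler P) (c : Config P) :
    Measure (ℕ → Config P) :=
  Kernel.traj (X := fun _ => Config P) (fun n => σ.kernel Υ n) 0 (fun _ => c)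

/-- The termination time of a run. -/
noncomputable def terminationTime {S : Ops} {Vp Vr : Type} {P : Prog S Vp Vr}
    (ω : ℕ → Config P) : ℕ∞ :=
  ⨅ (n : ℕ) (_ : (ω n).loc = P.lout), (n : ℕ∞)

/-- `P` is almost-surely terminating for every initial valuation (under every scheduler). -/
def Terminates {S : Ops} {Vp Vr : Type} [Fintype Vp] [Fintype Vr] [DecidableEq Vp]
    (Υ : Vr → PMF ℤ) (P : Prog S Vp Vr) : Prop :=
  ∀ (ν : Val Vp) (σ : Scheduler P),
    σ.runMeasure Υ ⟨P.lin, ν⟩ {ω | terminationTime ω < ⊤} = 1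

/-! ### Invariants and descent supermartingale maps -/

/-- The configurations that are visited in some run, from some initial valuation. -/
inductive Reachable {S : Ops} {Vp Vr : Type} [Fintype Vr] [DecidableEq Vp]
    (Υ : Vr → PMF ℤ) (P : Prog S Vp Vr) : Config P → Prop
  | start (ν : Val Vp) : Reachable Υ P ⟨P.lin, ν⟩
  | step (c c' : Config P) (α : Act) : Reachable Υ P c → α ∈ c.avail →
      c' ∈ (c.step Υ α).support → Reachable Υ P c'

/-- Invariants: over-approximations of the reachable configurations at every label. -/
def IsInvariant {S : Ops} {Vp Vr : Type} [Fintype Vr] [DecidableEq Vp]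
    (Υ : Vr → PMF ℤ) (P : Prog S Vp Vr) (I : P.Label → Set (Val Vp)) : Prop :=
  ∀ c : Config P, Reachable Υ P c → c.val ∈ I c.loc

/-- Partial DSMs: the conditions of a descent supermartingale map on the assignment, conditional,
nondeterministic and probabilistic labels. The sampled valuation `μ` ranges over the support of
the joint distribution. -/
structure IsPartialDSM {S : Ops} {Vp Vr : Type} [Fintype Vr] [DecidableEq Vp]
    (Υ : Vr → PMF ℤ) (P : Prog S Vp Vr) (ε a b : ℝ) (I : P.Label → Set (Val Vp))
    (η : P.Label → Val Vp → ℝ) : Prop where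
  assign_bounded : ∀ l u l', P.node l = .assign u l' → ∀ ν ∈ I (some l),
    ∀ μ ∈ (joint Υ).support,
      a ≤ η l' (u ν μ) - η (some l) ν ∧ η l' (u ν μ) - η (some l) ν ≤ b
  assign_decrease : ∀ l u l', P.node l = .assign u l' → ∀ ν ∈ I (some l),
    ∑' μ, (joint Υ μ).toReal * η l' (u ν μ) ≤ η (some l) ν - ε
  cond_then : ∀ l φ l₁ l₂, P.node l = .cond φ l₁ l₂ → ∀ ν ∈ I (some l), φ.Sat ν →
    a ≤ η l₁ ν - η (some l) ν ∧ η l₁ ν - η (some l) ν ≤ min (-ε) b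
  cond_else : ∀ l φ l₁ l₂, P.node l = .cond φ l₁ l₂ → ∀ ν ∈ I (some l), ¬ φ.Sat ν →
    a ≤ η l₂ ν - η (some l) ν ∧ η l₂ ν - η (some l) ν ≤ min (-ε) b
  nondet_then : ∀ l l₁ l₂, P.node l = .nondet l₁ l₂ → ∀ ν ∈ I (some l),
    a ≤ η l₁ ν - η (some l) ν ∧ η l₁ ν - η (some l) ν ≤ min (-ε) b
  nondet_else : ∀ l l₁ l₂, P.node l = .nondet l₁ l₂ → ∀ ν ∈ I (some l),
    a ≤ η l₂ ν - η (some l) ν ∧ η l₂ ν - η (some l) ν ≤ min (-ε) b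
  prob_bounded_then : ∀ l p l₁ l₂, P.node l = .prob p l₁ l₂ → ∀ ν ∈ I (some l),
    a ≤ η l₁ ν - η (some l) ν ∧ η l₁ ν - η (some l) ν ≤ b
  prob_bounded_else : ∀ l p l₁ l₂, P.node l = .prob p l₁ l₂ → ∀ ν ∈ I (some l),
    a ≤ η l₂ ν - η (some l) ν ∧ η l₂ ν - η (some l) ν ≤ b
  prob_decrease : ∀ l p l₁ l₂, P.node l = .prob p l₁ l₂ → ∀ ν ∈ I (some l),
    (p : ℝ) * η l₁ ν + (1 - p) * η l₂ ν ≤ η (some l) ν - ε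

/-- Descent supermartingale maps: in addition, `η` is bounded from below by `c` at every entry into
the body of an outermost loop. For `P = while G do P'`, this is: `c ≤ η(ℓ_in, ν)` for all
`ν ∈ I(ℓ_in)` with `ν ⊨ G`. -/
structure IsDSM {S : Ops} {Vp Vr : Type} [Fintype Vr] [DecidableEq Vp]
    (Υ : Vr → PMF ℤ) (P : Prog S Vp Vr) (ε c a b : ℝ) (I : P.Label → Set (Val Vp))
    (η : P.Label → Val Vp → ℝ) : Prop extends IsPartialDSM Υ P ε a b I η where
  lower_bound : ∀ l G, P.outerGuard l = some G → ∀ ν ∈ I (some l), G.Sat ν → c ≤ η (some l) ν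

theorem IsDSM.while_iff {S : Ops} {Vp Vr : Type} [Fintype Vr] [DecidableEq Vp]
    (Υ : Vr → PMF ℤ) (G : BExpr S Vp) (P : Prog S Vp Vr) (ε c a b : ℝ)
    (I : (Prog.while G P).Label → Set (Val Vp)) (η : (Prog.while G P).Label → Val Vp → ℝ) :
    IsDSM Υ (.while G P) ε c a b I η ↔ IsPartialDSM Υ (.while G P) ε a b I η ∧
      ∀ ν ∈ I (Prog.while G P).lin, G.Sat ν → c ≤ η (Prog.while G P).lin ν := by
  refine ⟨fun h => ⟨h.toIsPartialDSM, h.lower_bound none G rfl⟩, fun h => ⟨h.1, ?_⟩⟩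
  rintro (_ | l) G' hG'
  · obtain rfl : G = G' := Option.some.inj hG'
    exact h.2
  · cases hG'

/-! ### The proof system -/

/-- The two kinds of Hoare triples: `{R} P {R'}` and `⟨R⟩ P ⟨R'⟩`. -/
inductive Kind : Type
  | full | part

/-- The judgments: Hoare triples of either kind, and `Tm(P)`. -/
inductive Judgment (S : Ops) (Vp Vr : Type) : Type
  | triple (k : Kind) (R : RExpr S Vp) (P : Prog S Vp Vr) (R' : RExpr S Vp)
  | tm (P : Prog S Vp Vr)

/-- The meaning of the judgments: `{R} P {R'}` (resp. `⟨R⟩ P ⟨R'⟩`) says that `P` has a DSM-map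
(resp. a partial DSM) with the value `R` at the initial and `R'` at the terminal label. -/
def Judgment.Valid {S : Ops} {Vp Vr : Type} [Fintype Vp] [Fintype Vr] [DecidableEq Vp]
    (Υ : Vr → PMF ℤ) : Judgment S Vp Vr → Prop
  | .triple .full R P R' => ∃ ε c a b : ℝ, 0 < ε ∧ a ≤ b ∧
      ∃ (I : P.Label → Set (Val Vp)) (η : P.Label → Val Vp → ℝ),
        IsInvariant Υ P I ∧ IsDSM Υ P ε c a b I η ∧
        (∀ ν, η P.lin ν = R.eval ν) ∧ (∀ ν, η P.lout ν = R'.eval ν)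
  | .triple .part R P R' => ∃ ε a b : ℝ, 0 < ε ∧ a ≤ b ∧
      ∃ (I : P.Label → Set (Val Vp)) (η : P.Label → Val Vp → ℝ),
        IsInvariant Υ P I ∧ IsPartialDSM Υ P ε a b I η ∧
        (∀ ν, η P.lin ν = R.eval ν) ∧ (∀ ν, η P.lout ν = R'.eval ν)
  | .tm P => Terminates Υ P

/-- `R'[x ← e]`, an expression over the program and the sampling variables. -/
def RExpr.subst {S : Ops} {Vp Vr : Type} [DecidableEq Vp] (R' : RExpr S Vp) (x : Vp)
    (e : Expr S (Vp ⊕ Vr)) : RExpr S (Vp ⊕ Vr) :=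
  R'.bind fun y => if y = x then e else .var (Sum.inl y)

/-- The expected value of an expression over the program and the sampling variables, as a
function of the valuation of the program variables. -/
noncomputable def RExpr.expect {S : Ops} {Vp Vr : Type} [Fintype Vr] (Υ : Vr → PMF ℤ)
    (R : RExpr S (Vp ⊕ Vr)) (ν : Val Vp) : ℝ :=
  ∑' μ, (joint Υ μ).toReal * R.eval (Sum.elim ν μ)

/-- `a ≤ R' - R ≤ -ε` at the valuation `ν`. -/
def Drop {S : Ops} {Vp : Type} (a ε : ℝ) (R R' : RExpr S Vp) (ν : Val Vp) : Prop :=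
  a ≤ R'.eval ν - R.eval ν ∧ R'.eval ν - R.eval ν ≤ -ε

/-- The axioms and rules of the proof system, as a relation between the list of premises and the
conclusion. Premises that are not judgments are hypotheses of the constructors. -/
inductive Rule {S : Ops} {Vp Vr : Type} [Fintype Vr] [DecidableEq Vp] (Υ : Vr → PMF ℤ) :
    List (Judgment S Vp Vr) → Judgment S Vp Vr → Prop
  | while_full (R R' R'' : RExpr S Vp) (G : BExpr S Vp) (P : Prog S Vp Vr) (a c ε : ℝ) :
      0 < ε →
      (∀ ν, G.Sat ν → c ≤ R'.eval ν) →
      (∀ ν, G.Sat ν → Drop a ε R' R ν) →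
      (∀ ν, ¬ G.Sat ν → Drop a ε R' R'' ν) →
      Rule Υ [.triple .part R P R'] (.triple .full R' (.while G P) R'')
  | while_part (R R' R'' : RExpr S Vp) (G : BExpr S Vp) (P : Prog S Vp Vr) (a ε : ℝ) :
      0 < ε →
      (∀ ν, G.Sat ν → Drop a ε R' R ν) →
      (∀ ν, ¬ G.Sat ν → Drop a ε R' R'' ν) →
      Rule Υ [.triple .part R P R'] (.triple .part R' (.while G P) R'')
  | skip (k : Kind) (R R' : RExpr S Vp) (a ε : ℝ) :
      0 < ε →
      (∀ ν, Drop a ε R R' ν) →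
      Rule Υ [] (.triple k R .skip R')
  | assign (k : Kind) (R R' : RExpr S Vp) (x : Vp) (e : Expr S (Vp ⊕ Vr)) (a b ε : ℝ) :
      0 < ε →
      (∀ ν, ∀ μ ∈ (joint Υ).support,
        a ≤ (R'.subst x e).eval (Sum.elim ν μ) - R.eval ν ∧
        (R'.subst x e).eval (Sum.elim ν μ) - R.eval ν ≤ b) →
      (∀ ν, (R'.subst x e).expect Υ ν - R.eval ν ≤ -ε) →
      Rule Υ [] (.triple k R (.assign x e) R')
  | seq (k : Kind) (R R' R'' : RExpr S Vp) (P₁ P₂ : Prog S Vp Vr) :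
      Rule Υ [.triple k R P₁ R', .triple k R' P₂ R''] (.triple k R (.seq P₁ P₂) R'')
  | ite (k : Kind) (R R₁ R₂ R' : RExpr S Vp) (G : BExpr S Vp) (P₁ P₂ : Prog S Vp Vr) (a ε : ℝ) :
      0 < ε →
      (∀ ν, G.Sat ν → Drop a ε R R₁ ν) →
      (∀ ν, ¬ G.Sat ν → Drop a ε R R₂ ν) →
      Rule Υ [.triple k R₁ P₁ R', .triple k R₂ P₂ R'] (.triple k R (.ite G P₁ P₂) R')
  | nondet (k : Kind) (R R₁ R₂ R' : RExpr S Vp) (P₁ P₂ : Prog S Vp Vr) (a ε : ℝ) :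
      0 < ε →
      (∀ ν, Drop a ε R R₁ ν) →
      (∀ ν, Drop a ε R R₂ ν) →
      Rule Υ [.triple k R₁ P₁ R', .triple k R₂ P₂ R'] (.triple k R (.nondet P₁ P₂) R')
  | prob (k : Kind) (R R₁ R₂ R' : RExpr S Vp) (p : unitInterval) (P₁ P₂ : Prog S Vp Vr)
      (a b ε : ℝ) :
      0 < ε →
      (∀ ν, a ≤ R₁.eval ν - R.eval ν ∧ R₁.eval ν - R.eval ν ≤ b) →
      (∀ ν, a ≤ R₂.eval ν - R.eval ν ∧ R₂.eval ν - R.eval ν ≤ b) →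
      (∀ ν, (p : ℝ) * R₁.eval ν + (1 - p) * R₂.eval ν ≤ R.eval ν - ε) →
      Rule Υ [.triple k R₁ P₁ R', .triple k R₂ P₂ R'] (.triple k R (.prob p P₁ P₂) R')
  | tm_while (R₁ R₂ : RExpr S Vp) (G : BExpr S Vp) (P : Prog S Vp Vr) :
      Rule Υ [.tm P, .triple .full R₁ (.while G P) R₂] (.tm (.while G P))
  | tm_assign (x : Vp) (e : Expr S (Vp ⊕ Vr)) : Rule Υ [] (.tm (.assign x e))
  | tm_skip : Rule Υ [] (.tm .skip)
  | tm_seq (P₁ P₂ : Prog S Vp Vr) : Rule Υ [.tm P₁, .tm P₂] (.tm (.seq P₁ P₂))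
  | tm_ite (G : BExpr S Vp) (P₁ P₂ : Prog S Vp Vr) :
      Rule Υ [.tm P₁, .tm P₂] (.tm (.ite G P₁ P₂))
  | tm_nondet (P₁ P₂ : Prog S Vp Vr) : Rule Υ [.tm P₁, .tm P₂] (.tm (.nondet P₁ P₂))
  | tm_prob (p : unitInterval) (P₁ P₂ : Prog S Vp Vr) :
      Rule Υ [.tm P₁, .tm P₂] (.tm (.prob p P₁ P₂))

/-- Derivability in the proof system. -/
inductive Derivable {S : Ops} {Vp Vr : Type} [Fintype Vr] [DecidableEq Vp] (Υ : Vr → PMF ℤ) :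
    Judgment S Vp Vr → Prop
  | rule (Γ : List (Judgment S Vp Vr)) (J : Judgment S Vp Vr) :
      Rule Υ Γ J → (∀ K ∈ Γ, Derivable Υ K) → Derivable Υ J

end DSM

/-!
The soundness of the rules for termination rests on a description of almost-sure termination that
no longer mentions schedulers, histories or the measure on runs. A *subsolution* is a function `w`
on configurations with values in `[0, 1]` that vanishes at the terminal label and is nowhere larger
than its expected value after one transition under the best action. A program terminates almost
surely under every scheduler if and only if all its subsolutions vanish at the initial label
(`terminates_iff`). If a subsolution is positive there, then the memoryless scheduler that always
maximizes its expected value avoids the terminal label with positive probability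
(`Subsolution.le_runMeasure`). Conversely, the optimal probabilities of avoiding the terminal label
for `n` steps bound what any scheduler achieves (`Scheduler.runMeasure_avoiding_le`), and their
limit is a subsolution (`subsolution_iInf_avoid`): since there are finitely many actions, the
maximum commutes with the decreasing limit.

Subsolutions restrict to subprograms, which settles sequential composition and branching. For a
loop whose body terminates (`Terminates.while`), let `η` be a DSM-map. As its increments are
bounded and it decreases by `ε` in expectation, `f = exp (t η)` satisfies `E[f'] ≤ q f` in every
step, for some `t > 0` and `q < 1` (`exists_upper_exp_le`). A subsolution `w` of the loop is at most
`K f` at the label of the loop when the guard holds, because `η ≥ c` there, and zero when it fails.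
If `w ≤ θ f` holds at the label of the loop, then `w - θ f`, on the reachable configurations, is a
subsolution of the body, hence vanishes at its entry, and the step into the body improves the bound to `w ≤ q θ f`. Iterating,
`w = 0`.

The rules for triples glue the DSMs of the subprograms along the control flow graph. All
conditions are local to a node of the graph and are compatible with renaming its targets
(`Node.descends_map`); the parameters `ε`, `a`, `b`, `c` are merged into one bound `M` that may be
increased (`valid_triple_iff`); and a configuration that is reachable in the composite program is
reachable in the subprogram, since a run of the subprogram may start in any valuation.
-/

/-! ### Expectations of extended nonnegative functions under discrete distributions -/

namespace PMF

variable {α β : Type*}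

theorem tsum_pure_mul (a : α) (f : α → ℝ≥0∞) : ∑' x, pure a x * f x = f a := by
  rw [tsum_eq_single a fun x hx => by rw [pure_apply_of_ne _ _ hx, zero_mul], pure_apply_self,
    one_mul]

theorem tsum_bind_mul (p : PMF α) (q : α → PMF β) (f : β → ℝ≥0∞) :
    ∑' y, p.bind q y * f y = ∑' x, p x * ∑' y, q x y * f y := by
  simp_rw [bind_apply, ← ENNReal.tsum_mul_right, ← ENNReal.tsum_mul_left, mul_assoc]
  exact ENNReal.tsum_comm

theorem tsum_map_mul (p : PMF α) (g : α → β) (f : β → ℝ≥0∞) :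
    ∑' y, p.map g y * f y = ∑' x, p x * f (g x) := by
  rw [← bind_pure_comp, tsum_bind_mul]
  simp_rw [Function.comp_apply, tsum_pure_mul]

theorem tsum_mul_le (p : PMF α) {f g : α → ℝ≥0∞} (h : ∀ x ∈ p.support, f x ≤ g x) :
    ∑' x, p x * f x ≤ ∑' x, p x * g x := by
  refine ENNReal.tsum_le_tsum fun x => ?_
  by_cases hx : p x = 0
  · simp [hx]
  · exact mul_le_mul_right (h x hx) _

theorem tsum_mul_const (p : PMF α) (k : ℝ≥0∞) : ∑' x, p x * k = k := by
  rw [ENNReal.tsum_mul_right, p.tsum_coe, one_mul]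

/-- Monotone convergence from above, for functions bounded by `1`. -/
theorem tsum_mul_iInf (p : PMF α) {f : ℕ → α → ℝ≥0∞} (hf : Antitone f) (h1 : ∀ x, f 0 x ≤ 1) :
    ∑' x, p x * ⨅ n, f n x = ⨅ n, ∑' x, p x * f n x := by
  let _ : MeasurableSpace α := ⊤
  have h (x : α) : p x * ⨅ n, f n x = ⨅ n, p x * f n x :=
    ENNReal.mul_iInf fun hx => absurd hx (p.apply_ne_top x)
  simp_rw [h, ← lintegral_count]
  refine lintegral_iInf (fun n => measurable_from_top)
    (fun m n h x => mul_le_mul_right (hf h x) _) ?_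
  rw [lintegral_count]
  refine ne_top_of_le_ne_top ENNReal.one_ne_top ?_
  calc ∑' x, p x * f 0 x ≤ ∑' x, p x * 1 := p.tsum_mul_le fun x _ => h1 x
    _ = 1 := p.tsum_mul_const 1

theorem summable_toReal (p : PMF α) : Summable fun x => (p x).toReal :=
  ENNReal.summable_toReal (by rw [p.tsum_coe]; exact ENNReal.one_ne_top)

theorem tsum_toReal (p : PMF α) : ∑' x, (p x).toReal = 1 := by
  rw [← ENNReal.tsum_toReal_eq p.apply_ne_top, p.tsum_coe, ENNReal.toReal_one]

/-- A function that is bounded on the support has a summable expectation. -/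
theorem summable_toReal_mul (p : PMF α) {f : α → ℝ} {C : ℝ} (h : ∀ x ∈ p.support, |f x| ≤ C) :
    Summable fun x => (p x).toReal * f x := by
  refine Summable.of_norm_bounded (p.summable_toReal.mul_right C) fun x => ?_
  rw [Real.norm_eq_abs, abs_mul, abs_of_nonneg ENNReal.toReal_nonneg]
  by_cases hx : p x = 0
  · simp [hx]
  · exact mul_le_mul_of_nonneg_left (h x hx) ENNReal.toReal_nonneg

end PMF

namespace DSM

variable {S : Ops} {Vp Vr L L' : Type} [Fintype Vr]

/-! ### One step of the control flow graph -/

/-- The largest expected value of `w` after one transition from a label with transitions `n` at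
the valuation `ν`, where the maximum is over the available actions. -/
noncomputable def Node.upper (Υ : Vr → PMF ℤ) (n : Node S Vp Vr L) (ν : Val Vp)
    (w : L → Val Vp → ℝ≥0∞) : ℝ≥0∞ :=
  open Classical in
  match n with
  | .assign u l => ∑' μ, joint Υ μ * w l (u ν μ)
  | .cond φ l₁ l₂ => w (if φ.Sat ν then l₁ else l₂) ν
  | .prob p l₁ l₂ => ∑' h, coin p h * w (if h then l₁ else l₂) ν
  | .nondet l₁ l₂ => max (w l₁ ν) (w l₂ ν)

/-- `n.Succ Υ ν l' ν'`: some available action leads from `ν`, at a label with transitions `n`, to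
`(l', ν')` with positive probability. -/
def Node.Succ (Υ : Vr → PMF ℤ) (n : Node S Vp Vr L) (ν : Val Vp) (l' : L) (ν' : Val Vp) : Prop :=
  open Classical in
  match n with
  | .assign u l => ∃ μ ∈ (joint Υ).support, l = l' ∧ u ν μ = ν'
  | .cond φ l₁ l₂ => (if φ.Sat ν then l₁ else l₂) = l' ∧ ν = ν'
  | .prob p l₁ l₂ => ∃ h ∈ (coin p).support, (if h then l₁ else l₂) = l' ∧ ν = ν'
  | .nondet l₁ l₂ => (l₁ = l' ∨ l₂ = l') ∧ ν = ν'

/-- The conditions of a partial DSM `η` at one label with transitions `n` and at one valuation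
`ν`, where `x` is the value of `η` at that label and valuation. -/
def Node.Descends (Υ : Vr → PMF ℤ) (ε a b : ℝ) (n : Node S Vp Vr L) (ν : Val Vp) (x : ℝ)
    (η : L → Val Vp → ℝ) : Prop :=
  match n with
  | .assign u l =>
      (∀ μ ∈ (joint Υ).support, a ≤ η l (u ν μ) - x ∧ η l (u ν μ) - x ≤ b) ∧
      ∑' μ, (joint Υ μ).toReal * η l (u ν μ) ≤ x - ε
  | .cond φ l₁ l₂ =>
      (φ.Sat ν → a ≤ η l₁ ν - x ∧ η l₁ ν - x ≤ min (-ε) b) ∧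
      (¬ φ.Sat ν → a ≤ η l₂ ν - x ∧ η l₂ ν - x ≤ min (-ε) b)
  | .prob p l₁ l₂ =>
      (a ≤ η l₁ ν - x ∧ η l₁ ν - x ≤ b) ∧ (a ≤ η l₂ ν - x ∧ η l₂ ν - x ≤ b) ∧
      (p : ℝ) * η l₁ ν + (1 - p) * η l₂ ν ≤ x - ε
  | .nondet l₁ l₂ =>
      (a ≤ η l₁ ν - x ∧ η l₁ ν - x ≤ min (-ε) b) ∧ (a ≤ η l₂ ν - x ∧ η l₂ ν - x ≤ min (-ε) b)

variable {Υ : Vr → PMF ℤ} {ν ν' : Val Vp}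

theorem Node.upper_map (n : Node S Vp Vr L) (f : L → L') (w : L' → Val Vp → ℝ≥0∞) :
    (n.map f).upper Υ ν w = n.upper Υ ν fun l => w (f l) := by
  cases n <;> simp only [Node.map, Node.upper, apply_ite f]

theorem Node.succ_map (n : Node S Vp Vr L) (f : L → L') {l' : L'} :
    (n.map f).Succ Υ ν l' ν' ↔ ∃ l, f l = l' ∧ n.Succ Υ ν l ν' := by
  cases n <;> simp only [Node.map, Node.Succ, ← apply_ite f] <;> grind

theorem Node.descends_map (n : Node S Vp Vr L) (f : L → L') {ε a b x : ℝ}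
    {η : L' → Val Vp → ℝ} :
    (n.map f).Descends Υ ε a b ν x η ↔ n.Descends Υ ε a b ν x fun l => η (f l) := by
  cases n <;> exact Iff.rfl

theorem Node.Descends.mono {n : Node S Vp Vr L} {ε ε' a a' b b' x : ℝ} {η : L → Val Vp → ℝ}
    (h : n.Descends Υ ε a b ν x η) (hε : ε' ≤ ε) (ha : a' ≤ a) (hb : b ≤ b') :
    n.Descends Υ ε' a' b' ν x η := by
  have hm : min (-ε) b ≤ min (-ε') b' := min_le_min (neg_le_neg hε) hb
  cases n with
  | assign u l =>
    exact ⟨fun μ hμ => ⟨ha.trans (h.1 μ hμ).1, (h.1 μ hμ).2.trans hb⟩, by linarith [h.2]⟩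
  | cond φ l₁ l₂ =>
    exact ⟨fun hs => ⟨ha.trans (h.1 hs).1, (h.1 hs).2.trans hm⟩,
      fun hs => ⟨ha.trans (h.2 hs).1, (h.2 hs).2.trans hm⟩⟩
  | prob p l₁ l₂ =>
    exact ⟨⟨ha.trans h.1.1, h.1.2.trans hb⟩, ⟨ha.trans h.2.1.1, h.2.1.2.trans hb⟩,
      by linarith [h.2.2]⟩
  | nondet l₁ l₂ =>
    exact ⟨⟨ha.trans h.1.1, h.1.2.trans hm⟩, ⟨ha.trans h.2.1, h.2.2.trans hm⟩⟩

theorem Node.upper_mono (n : Node S Vp Vr L) {w w' : L → Val Vp → ℝ≥0∞}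
    (h : ∀ l' ν', n.Succ Υ ν l' ν' → w l' ν' ≤ w' l' ν') : n.upper Υ ν w ≤ n.upper Υ ν w' := by
  cases n with
  | assign u l => exact PMF.tsum_mul_le _ fun μ hμ => h _ _ ⟨μ, hμ, rfl, rfl⟩
  | cond φ l₁ l₂ => exact h _ _ ⟨rfl, rfl⟩
  | prob p l₁ l₂ => exact PMF.tsum_mul_le _ fun b hb => h _ _ ⟨b, hb, rfl, rfl⟩
  | nondet l₁ l₂ => exact max_le_max (h _ _ ⟨.inl rfl, rfl⟩) (h _ _ ⟨.inr rfl, rfl⟩)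

theorem Node.upper_add_le (n : Node S Vp Vr L) (w w' : L → Val Vp → ℝ≥0∞) :
    n.upper Υ ν (fun l μ => w l μ + w' l μ) ≤ n.upper Υ ν w + n.upper Υ ν w' := by
  cases n with
  | assign u l => simp only [Node.upper, mul_add, ENNReal.tsum_add, le_refl]
  | cond φ l₁ l₂ => exact le_rfl
  | prob p l₁ l₂ => simp only [Node.upper, mul_add, ENNReal.tsum_add, le_refl]
  | nondet l₁ l₂ =>
    exact max_le (add_le_add (le_max_left _ _) (le_max_left _ _))
      (add_le_add (le_max_right _ _) (le_max_right _ _))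

theorem Node.upper_const_mul (n : Node S Vp Vr L) (k : ℝ≥0∞) (w : L → Val Vp → ℝ≥0∞) :
    n.upper Υ ν (fun l μ => k * w l μ) = k * n.upper Υ ν w := by
  cases n with
  | assign u l => simp only [Node.upper, mul_left_comm _ k, ENNReal.tsum_mul_left]
  | cond φ l₁ l₂ => rfl
  | prob p l₁ l₂ => simp only [Node.upper, mul_left_comm _ k, ENNReal.tsum_mul_left]
  | nondet l₁ l₂ => exact (mul_max_of_nonneg _ _ (zero_le)).symm

theorem Node.upper_le_one (n : Node S Vp Vr L) {w : L → Val Vp → ℝ≥0∞} (h : ∀ l ν, w l ν ≤ 1) :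
    n.upper Υ ν w ≤ 1 := by
  refine (n.upper_mono (w' := fun _ _ => 1) fun l ν _ => h l ν).trans ?_
  cases n with
  | assign u l => exact (PMF.tsum_mul_const _ 1).le
  | cond φ l₁ l₂ => exact le_rfl
  | prob p l₁ l₂ => exact (PMF.tsum_mul_const _ 1).le
  | nondet l₁ l₂ => exact (max_self _).le

/-- The maximum over the actions commutes with decreasing limits, because there are finitely many
actions. -/
theorem Node.upper_iInf (n : Node S Vp Vr L) {w : ℕ → L → Val Vp → ℝ≥0∞} (hw : Antitone w)
    (h1 : ∀ l ν, w 0 l ν ≤ 1) :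
    n.upper Υ ν (fun l μ => ⨅ k, w k l μ) = ⨅ k, n.upper Υ ν (w k) := by
  cases n with
  | assign u l => exact PMF.tsum_mul_iInf _ (fun i j h μ => hw h _ _) fun μ => h1 _ _
  | cond φ l₁ l₂ => rfl
  | prob p l₁ l₂ => exact PMF.tsum_mul_iInf _ (fun i j h μ => hw h _ _) fun μ => h1 _ _
  | nondet l₁ l₂ =>
    exact (iInf_sup_of_antitone (fun i j h => hw h _ _) fun i j h => hw h _ _).symm

/-! ### One step of the Markov decision process -/

variable [DecidableEq Vp] {P : Prog S Vp Vr}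

theorem tsum_step_le_upper (l : P.Loc) (w : P.Label → Val Vp → ℝ≥0∞) {α : Act}
    (hα : α ∈ (⟨some l, ν⟩ : Config P).avail) :
    ∑' c, Config.step Υ ⟨some l, ν⟩ α c * w c.loc c.val ≤ (P.node l).upper Υ ν w := by
  simp only [Config.avail, Config.step] at hα ⊢
  cases hn : P.node l with
  | assign u l' => simp only [PMF.tsum_map_mul, Node.upper, le_refl]
  | cond φ l₁ l₂ => simp only [PMF.tsum_pure_mul, Node.upper, le_refl]
  | prob p l₁ l₂ => simp only [PMF.tsum_map_mul, Node.upper, le_refl]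
  | nondet l₁ l₂ =>
    rw [hn] at hα
    rcases hα with rfl | rfl <;> simp only [PMF.tsum_pure_mul, Node.upper]
    · exact le_max_left _ _
    · exact le_max_right _ _

theorem exists_upper_eq_tsum_step (l : P.Loc) (ν : Val Vp) (w : P.Label → Val Vp → ℝ≥0∞) :
    ∃ α ∈ (⟨some l, ν⟩ : Config P).avail,
      (P.node l).upper Υ ν w = ∑' c, Config.step Υ ⟨some l, ν⟩ α c * w c.loc c.val := by
  simp only [Config.avail, Config.step]
  cases hn : P.node l with
  | assign u l' => exact ⟨.tau, rfl, by simp only [PMF.tsum_map_mul, Node.upper]⟩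
  | cond φ l₁ l₂ => exact ⟨.tau, rfl, by simp only [PMF.tsum_pure_mul, Node.upper]⟩
  | prob p l₁ l₂ => exact ⟨.tau, rfl, by simp only [PMF.tsum_map_mul, Node.upper]⟩
  | nondet l₁ l₂ =>
    rcases le_total (w l₁ ν) (w l₂ ν) with h | h
    · exact ⟨.el, .inr rfl, by simp only [PMF.tsum_pure_mul, Node.upper, max_eq_right h]⟩
    · exact ⟨.th, .inl rfl, by simp only [PMF.tsum_pure_mul, Node.upper, max_eq_left h]⟩

theorem succ_of_mem_support_step {l : P.Loc} {α : Act} {c : Config P}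
    (hα : α ∈ (⟨some l, ν⟩ : Config P).avail) (hc : c ∈ (Config.step Υ ⟨some l, ν⟩ α).support) :
    (P.node l).Succ Υ ν c.loc c.val := by
  simp only [Config.avail, Config.step] at hα hc
  cases hn : P.node l with
  | assign u l' =>
    rw [hn] at hc
    obtain ⟨μ, hμ, rfl⟩ := (PMF.mem_support_map_iff _ _ _).1 hc
    exact ⟨μ, hμ, rfl, rfl⟩
  | cond φ l₁ l₂ =>
    rw [hn] at hc
    obtain rfl := (PMF.mem_support_pure_iff _ _).1 hc
    exact ⟨rfl, rfl⟩
  | prob p l₁ l₂ =>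
    rw [hn] at hc
    obtain ⟨h, hh, rfl⟩ := (PMF.mem_support_map_iff _ _ _).1 hc
    exact ⟨h, hh, rfl, rfl⟩
  | nondet l₁ l₂ =>
    rw [hn] at hc hα
    rcases hα with rfl | rfl <;> obtain rfl := (PMF.mem_support_pure_iff _ _).1 hc
    · exact ⟨.inl rfl, rfl⟩
    · exact ⟨.inr rfl, rfl⟩

theorem exists_mem_support_step {l : P.Loc} {l' : P.Label} (h : (P.node l).Succ Υ ν l' ν') :
    ∃ α ∈ (⟨some l, ν⟩ : Config P).avail,
      (⟨l', ν'⟩ : Config P) ∈ (Config.step Υ ⟨some l, ν⟩ α).support := by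
  simp only [Config.avail, Config.step]
  cases hn : P.node l with
  | assign u l' =>
    rw [hn] at h
    obtain ⟨μ, hμ, rfl, rfl⟩ := h
    exact ⟨.tau, rfl, (PMF.mem_support_map_iff _ _ _).2 ⟨μ, hμ, rfl⟩⟩
  | cond φ l₁ l₂ =>
    rw [hn] at h
    obtain ⟨rfl, rfl⟩ := h
    exact ⟨.tau, rfl, (PMF.mem_support_pure_iff _ _).2 rfl⟩
  | prob p l₁ l₂ =>
    rw [hn] at h
    obtain ⟨b, hb, rfl, rfl⟩ := h
    exact ⟨.tau, rfl, (PMF.mem_support_map_iff _ _ _).2 ⟨b, hb, rfl⟩⟩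
  | nondet l₁ l₂ =>
    rw [hn] at h
    obtain ⟨rfl | rfl, rfl⟩ := h
    · exact ⟨.th, .inl rfl, (PMF.mem_support_pure_iff _ _).2 rfl⟩
    · exact ⟨.el, .inr rfl, (PMF.mem_support_pure_iff _ _).2 rfl⟩

theorem Reachable.succ {l : P.Loc} {l' : P.Label} (h : Reachable Υ P ⟨some l, ν⟩)
    (hs : (P.node l).Succ Υ ν l' ν') : Reachable Υ P ⟨l', ν'⟩ := by
  obtain ⟨α, hα, hc⟩ := exists_mem_support_step hs
  exact .step _ _ α h hα hc

/-- Induction over the reachable configurations with a non-terminal label. -/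
theorem Reachable.loc_induction {C : P.Loc → Val Vp → Prop} (start : ∀ ν, C P.entry ν)
    (succ : ∀ l ν l' ν', C l ν → (P.node l).Succ Υ ν (some l') ν' → C l' ν')
    {l : P.Loc} (h : Reachable Υ P ⟨some l, ν⟩) : C l ν := by
  suffices H : ∀ c, Reachable Υ P c → ∀ l, c.loc = some l → C l c.val from H _ h l rfl
  intro c hc
  induction hc with
  | start ν =>
    intro l hl
    obtain rfl := Option.some.inj hl
    exact start ν
  | step c c' α _ hα hc' ih =>
    intro l' hl'
    rcases c with ⟨_ | l, ν⟩
    · obtain rfl : c' = _ := (PMF.mem_support_pure_iff _ _).1 hc'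
      cases hl'
    · have hs := succ_of_mem_support_step hα hc'
      rw [hl'] at hs
      exact succ l ν l' _ (ih l rfl) hs

theorem isPartialDSM_iff {ε a b : ℝ} {I : P.Label → Set (Val Vp)} {η : P.Label → Val Vp → ℝ} :
    IsPartialDSM Υ P ε a b I η ↔ ∀ l, ∀ ν ∈ I (some l),
      (P.node l).Descends Υ ε a b ν (η (some l) ν) η := by
  constructor
  · intro h l ν hν
    cases hn : P.node l with
    | assign u l' => exact ⟨h.assign_bounded l u l' hn ν hν, h.assign_decrease l u l' hn ν hν⟩
    | cond φ l₁ l₂ => exact ⟨h.cond_then l φ l₁ l₂ hn ν hν, h.cond_else l φ l₁ l₂ hn ν hν⟩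
    | prob p l₁ l₂ =>
      exact ⟨h.prob_bounded_then l p l₁ l₂ hn ν hν, h.prob_bounded_else l p l₁ l₂ hn ν hν,
        h.prob_decrease l p l₁ l₂ hn ν hν⟩
    | nondet l₁ l₂ => exact ⟨h.nondet_then l l₁ l₂ hn ν hν, h.nondet_else l l₁ l₂ hn ν hν⟩
  · intro h
    constructor <;> intro l
    · intro u l' hn ν hν; have := h l ν hν; rw [hn] at this; exact this.1
    · intro u l' hn ν hν; have := h l ν hν; rw [hn] at this; exact this.2
    · intro φ l₁ l₂ hn ν hν; have := h l ν hν; rw [hn] at this; exact this.1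
    · intro φ l₁ l₂ hn ν hν; have := h l ν hν; rw [hn] at this; exact this.2
    · intro l₁ l₂ hn ν hν; have := h l ν hν; rw [hn] at this; exact this.1
    · intro l₁ l₂ hn ν hν; have := h l ν hν; rw [hn] at this; exact this.2
    · intro p l₁ l₂ hn ν hν; have := h l ν hν; rw [hn] at this; exact this.1
    · intro p l₁ l₂ hn ν hν; have := h l ν hν; rw [hn] at this; exact this.2.1
    · intro p l₁ l₂ hn ν hν; have := h l ν hν; rw [hn] at this; exact this.2.2

end DSM

namespace DSM

/-! ### Subsolutions of the optimality equation -/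

section Subsolution

variable {S : Ops} {Vp Vr : Type} [Fintype Vr] [DecidableEq Vp] {Υ : Vr → PMF ℤ}
  {P : Prog S Vp Vr}

/-- A subsolution of the optimality equation for avoiding the terminal label: a function with
values in `[0, 1]` that vanishes at the terminal label and is, at every other configuration, at
most its expected value after one transition, under the best action. -/
structure Subsolution (Υ : Vr → PMF ℤ) (P : Prog S Vp Vr) (w : P.Label → Val Vp → ℝ≥0∞) :
    Prop where
  out : ∀ ν, w none ν = 0
  le_one : ∀ l ν, w l ν ≤ 1
  le_upper : ∀ l ν, w (some l) ν ≤ (P.node l).upper Υ ν w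

/-- The probability of avoiding the terminal label for `n` steps under an optimal scheduler, by
backward iteration. -/
noncomputable def avoid (Υ : Vr → PMF ℤ) (P : Prog S Vp Vr) : ℕ → P.Label → Val Vp → ℝ≥0∞
  | _, none, _ => 0
  | 0, some _, _ => 1
  | n + 1, some l, ν => (P.node l).upper Υ ν (avoid Υ P n)

theorem avoid_none (n : ℕ) (ν : Val Vp) : avoid Υ P n none ν = 0 := by
  cases n <;> rfl

theorem avoid_le_one (n : ℕ) (l : P.Label) (ν : Val Vp) : avoid Υ P n l ν ≤ 1 := by
  induction n generalizing l ν with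
  | zero => cases l <;> simp [avoid]
  | succ n ih =>
    cases l with
    | none => simp [avoid]
    | some l => exact Node.upper_le_one _ ih

theorem antitone_avoid : Antitone (avoid Υ P) := by
  refine antitone_nat_of_succ_le fun n => ?_
  induction n with
  | zero =>
    rintro (_ | l) ν
    · simp [avoid_none]
    · exact avoid_le_one _ _ _
  | succ n ih =>
    rintro (_ | l) ν
    · simp [avoid_none]
    · exact Node.upper_mono _ fun l' ν' _ => ih l' ν'

theorem subsolution_iInf_avoid : Subsolution Υ P fun l ν => ⨅ n, avoid Υ P n l ν where
  out ν := by simp [avoid_none]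
  le_one l ν := (iInf_le _ 0).trans (avoid_le_one 0 l ν)
  le_upper l ν := by
    rw [Node.upper_iInf _ antitone_avoid fun l ν => avoid_le_one 0 l ν]
    exact le_iInf fun n => iInf_le _ (n + 1)

theorem exists_optimal_action (w : P.Label → Val Vp → ℝ≥0∞) (c : Config P) :
    ∃ α ∈ c.avail, ∀ l, c.loc = some l →
      (P.node l).upper Υ c.val w = ∑' c', c.step Υ α c' * w c'.loc c'.val := by
  rcases c with ⟨_ | l, ν⟩
  · exact ⟨.tau, rfl, by simp⟩
  · obtain ⟨α, hα, h⟩ := exists_upper_eq_tsum_step (Υ := Υ) l ν w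
    refine ⟨α, hα, fun l' hl' => ?_⟩
    obtain rfl := Option.some.inj hl'
    exact h

/-- The memoryless scheduler that maximizes the expected value of `w` after one step. -/
noncomputable def optimalScheduler (Υ : Vr → PMF ℤ) (P : Prog S Vp Vr)
    (w : P.Label → Val Vp → ℝ≥0∞) : Scheduler P where
  choose _ h := PMF.pure (exists_optimal_action (Υ := Υ) w h.last).choose
  choose_avail n h := by
    rw [PMF.support_pure, Set.singleton_subset_iff]
    exact (exists_optimal_action (Υ := Υ) w h.last).choose_spec.1

theorem Scheduler.tsum_next_mul (σ : Scheduler P) (n : ℕ) (h : History P n)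
    (W : Config P → ℝ≥0∞) :
    ∑' c, σ.next Υ n h c * W c = ∑' α, σ.choose n h α * ∑' c, h.last.step Υ α c * W c :=
  PMF.tsum_bind_mul _ _ _

end Subsolution

/-! ### Runs that avoid the terminal label -/

section Runs

variable {S : Ops} {Vp Vr : Type}

/-- The runs that avoid the terminal label up to time `n`. -/
def avoiding (P : Prog S Vp Vr) (n : ℕ) : Set (ℕ → Config P) :=
  {ω | ∀ i ≤ n, (ω i).loc ≠ none}

theorem measurableSet_avoiding (P : Prog S Vp Vr) (n : ℕ) : MeasurableSet (avoiding P n) := by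
  have h : avoiding P n = ⋂ i ≤ n, (fun ω => ω i) ⁻¹' {c : Config P | c.loc ≠ none} := by
    ext ω
    simp [avoiding]
  rw [h]
  exact MeasurableSet.iInter fun i => MeasurableSet.iInter fun _ =>
    measurable_pi_apply i MeasurableSet.of_discrete

theorem setOf_terminationTime_lt_top (P : Prog S Vp Vr) :
    {ω : ℕ → Config P | terminationTime ω < ⊤} = (⋂ n, avoiding P n)ᶜ := by
  ext ω
  simp only [terminationTime, iInf_lt_iff, Set.mem_ofPred_eq, Set.mem_compl_iff, Set.mem_iInter,
    not_forall, not_not, Prog.lout, ENat.natCast_lt_top, exists_prop, and_true, avoiding]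
  exact ⟨fun ⟨n, h⟩ => ⟨n, n, le_rfl, h⟩, fun ⟨_, i, _, h⟩ => ⟨i, h⟩⟩

variable [Fintype Vp] [Fintype Vr] [DecidableEq Vp] {Υ : Vr → PMF ℤ} {P : Prog S Vp Vr}

instance (σ : Scheduler P) (c : Config P) : IsProbabilityMeasure (σ.runMeasure Υ c) := by
  unfold Scheduler.runMeasure; infer_instance

/-- The Markov property: integrating over the next configuration, given the history. -/
theorem Scheduler.lintegral_runMeasure_succ (σ : Scheduler P) (c : Config P) (n : ℕ)
    (g : History P n → Config P → ℝ≥0∞) :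
    ∫⁻ ω, g (Preorder.frestrictLe n ω) (ω (n + 1)) ∂σ.runMeasure Υ c =
      ∫⁻ ω, ∑' c', σ.next Υ n (Preorder.frestrictLe n ω) c' * g (Preorder.frestrictLe n ω) c'
        ∂σ.runMeasure Υ c := by
  have hg : Measurable (Function.uncurry g) := Measurable.of_discrete
  have key := Kernel.partialTraj_compProd_eq_map_traj (X := fun _ => Config P)
    (κ := fun n => σ.kernel Υ n) (Nat.zero_le n) (x₀ := fun _ => c)
  have h1 := congrArg (fun m => ∫⁻ z, Function.uncurry g z ∂m) key
  rw [lintegral_map hg (by fun_prop), Measure.lintegral_compProd hg,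
    ← Kernel.traj_map_frestrictLe_apply, lintegral_map Measurable.of_discrete (by fun_prop)] at h1
  refine h1.symm.trans (lintegral_congr fun ω => ?_)
  rw [lintegral_countable']
  refine tsum_congr fun c' => ?_
  rw [mul_comm]
  congr 1
  exact PMF.toMeasure_apply_singleton _ _ (measurableSet_singleton _)

theorem Scheduler.runMeasure_zero (σ : Scheduler P) (c : Config P) :
    ∀ᵐ ω ∂σ.runMeasure Υ c, ω 0 = c := by
  have h := Kernel.traj_map_frestrictLe_apply (X := fun _ => Config P)
    (κ := fun n => σ.kernel Υ n) 0 0 (fun _ => c)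
  rw [Kernel.partialTraj_self, Kernel.id_apply] at h
  have h2 : ∀ᵐ x ∂((σ.runMeasure Υ c).map (Preorder.frestrictLe 0)),
      x ⟨0, by simp⟩ = c := by
    unfold Scheduler.runMeasure
    rw [h, ae_dirac_eq]
    rfl
  exact ae_of_ae_map (by fun_prop) h2

theorem runMeasure_terminationTime_eq_one_iff (σ : Scheduler P) (c : Config P) :
    σ.runMeasure Υ c {ω | terminationTime ω < ⊤} = 1 ↔
      σ.runMeasure Υ c (⋂ n, avoiding P n) = 0 := by
  rw [setOf_terminationTime_lt_top, prob_compl_eq_one_iff]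
  exact MeasurableSet.iInter fun n => measurableSet_avoiding P n

/-- No scheduler does better than `avoid`: the expected value of `avoid Υ P (n - i)` at the `i`-th
configuration of a run does not increase with `i`. -/
theorem Scheduler.runMeasure_avoiding_le (σ : Scheduler P) (c : Config P) (n : ℕ) :
    σ.runMeasure Υ c (avoiding P n) ≤ avoid Υ P n c.loc c.val := by
  have main (m k : ℕ) : ∫⁻ ω, avoid Υ P k (ω m).loc (ω m).val ∂σ.runMeasure Υ c ≤
      avoid Υ P (k + m) c.loc c.val := by
    induction m generalizing k with
    | zero =>
      refine (lintegral_congr_ae (g := fun _ => avoid Υ P k c.loc c.val) ?_).le.trans ?_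
      · filter_upwards [σ.runMeasure_zero (Υ := Υ) c] with ω hω
        rw [hω]
      · simp
    | succ m ih =>
      refine le_trans ?_ ((ih (k + 1)).trans_eq (by rw [add_right_comm, add_assoc]))
      rw [σ.lintegral_runMeasure_succ c m fun _ c => avoid Υ P k c.loc c.val]
      refine lintegral_mono fun ω => ?_
      set h : History P m := Preorder.frestrictLe m ω
      change _ ≤ avoid Υ P (k + 1) h.last.loc h.last.val
      rw [σ.tsum_next_mul, ← PMF.tsum_mul_const (σ.choose m h) (avoid Υ P (k + 1) _ _)]
      refine PMF.tsum_mul_le _ fun α hα => ?_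
      have hav := σ.choose_avail m h hα
      generalize h.last = d at hav
      rcases d with ⟨_ | l, ν⟩
      · simp only [Config.step, PMF.tsum_pure_mul, avoid_none, le_refl]
      · exact tsum_step_le_upper l _ hav
  refine le_trans ?_ ((main n 0).trans_eq (by rw [zero_add]))
  rw [← lintegral_indicator_one (measurableSet_avoiding P n)]
  refine lintegral_mono fun ω => Set.indicator_apply_le' (fun hω => ?_) fun _ => zero_le
  obtain ⟨l, hl⟩ := Option.ne_none_iff_exists'.1 (hω n le_rfl)
  rw [hl]
  rfl

/-- Under the optimal scheduler of a subsolution `w`, a run avoids the terminal label forever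
with probability at least the initial value of `w`. -/
theorem Subsolution.le_runMeasure {w : P.Label → Val Vp → ℝ≥0∞} (hw : Subsolution Υ P w)
    (c : Config P) :
    w c.loc c.val ≤ (optimalScheduler Υ P w).runMeasure Υ c (⋂ n, avoiding P n) := by
  classical
  set σ := optimalScheduler Υ P w with hσ
  -- The expected value of `w`, restricted to the runs that have avoided the terminal label so
  -- far, does not decrease with time.
  have main (n : ℕ) : w c.loc c.val ≤
      ∫⁻ ω, (avoiding P n).indicator (fun ω => w (ω n).loc (ω n).val) ω ∂σ.runMeasure Υ c := by
    induction n with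
    | zero =>
      refine le_trans ?_ (lintegral_congr_ae (f := fun _ => w c.loc c.val) ?_).le
      · simp
      · filter_upwards [σ.runMeasure_zero (Υ := Υ) c] with ω hω
        rw [Set.indicator_apply]
        split_ifs with h
        · rw [hω]
        · have : c.loc = none := by simpa [hω, avoiding] using h
          rw [this, hw.out]
    | succ n ih =>
      refine ih.trans ?_
      let A : Set (History P n) := {h | ∀ i : Finset.Iic n, (h i).loc ≠ none}
      have hA (ω : ℕ → Config P) : Preorder.frestrictLe n ω ∈ A ↔ ω ∈ avoiding P n :=
        ⟨fun h i hi => h ⟨i, Finset.mem_Iic.2 hi⟩, fun h i => h i (Finset.mem_Iic.1 i.2)⟩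
      have hsucc (ω : ℕ → Config P) :
          (avoiding P (n + 1)).indicator (fun ω => w (ω (n + 1)).loc (ω (n + 1)).val) ω =
            if Preorder.frestrictLe n ω ∈ A then w (ω (n + 1)).loc (ω (n + 1)).val else 0 := by
        rw [Set.indicator_apply]
        by_cases h : (ω (n + 1)).loc = none
        · simp only [h, hw.out, ite_self]
        · refine if_congr ?_ rfl rfl
          rw [hA]
          refine ⟨fun hω i hi => hω i (hi.trans n.le_succ), fun hω i hi => ?_⟩
          rcases Nat.le_succ_iff.1 hi with hi | rfl
          · exact hω i hi
          · exact h
      simp_rw [hsucc]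
      rw [σ.lintegral_runMeasure_succ c n fun h c => if h ∈ A then w c.loc c.val else 0]
      refine lintegral_mono fun ω => Set.indicator_apply_le' (fun hω => ?_) fun _ => zero_le
      have hAω := (hA ω).2 hω
      set h : History P n := Preorder.frestrictLe n ω
      simp only [if_pos hAω]
      change w h.last.loc h.last.val ≤ _
      rw [σ.tsum_next_mul, hσ]
      simp only [optimalScheduler, PMF.tsum_pure_mul]
      have hopt := (exists_optimal_action (Υ := Υ) w h.last).choose_spec.2
      obtain ⟨l, hl⟩ : ∃ l, h.last.loc = some l := Option.ne_none_iff_exists'.1 (hω n le_rfl)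
      rw [← hopt l hl, hl]
      exact hw.le_upper l _
  refine ge_of_tendsto' (tendsto_measure_iInter_atTop
    (fun n => (measurableSet_avoiding P n).nullMeasurableSet)
    (fun m n hmn ω hω i hi => hω i (hi.trans hmn)) ⟨0, measure_ne_top _ _⟩) fun n => ?_
  refine (main n).trans ?_
  rw [Function.comp_apply, ← lintegral_indicator_one (measurableSet_avoiding P n)]
  exact lintegral_mono fun ω => Set.indicator_le_indicator (hw.le_one _ _)

/-- The elimination of schedulers and of the measure on runs: termination in terms of one-step
expectations only. -/
theorem terminates_iff :
    Terminates Υ P ↔ ∀ w, Subsolution Υ P w → ∀ ν, w P.lin ν = 0 := by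
  constructor
  · intro h w hw ν
    have h0 := (runMeasure_terminationTime_eq_one_iff _ _).1 (h ν (optimalScheduler Υ P w))
    exact le_antisymm (h0 ▸ hw.le_runMeasure ⟨P.lin, ν⟩) zero_le
  · intro h ν σ
    rw [runMeasure_terminationTime_eq_one_iff]
    refine le_antisymm ?_ zero_le
    rw [← h _ subsolution_iInf_avoid ν]
    exact le_iInf fun n => (measure_mono (Set.iInter_subset _ n)).trans
      (σ.runMeasure_avoiding_le ⟨P.lin, ν⟩ n)

end Runs

end DSM

/-! ### Exponential supermartingales -/

/-- A random variable with values in `[x + a, x + b]` and mean at most `x - ε` has a small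
exponential moment at a small parameter `t`: the factor `q < 1` depends on `ε`, `a`, `b` only. -/
theorem PMF.exists_tsum_exp_le {ε : ℝ} (hε : 0 < ε) (a b : ℝ) :
    ∃ t : ℝ, 0 < t ∧ ∃ q : ℝ≥0∞, q < 1 ∧ ∀ {α : Type} (p : PMF α) (g : α → ℝ) (x : ℝ),
      (∀ i ∈ p.support, a ≤ g i - x ∧ g i - x ≤ b) → ∑' i, (p i).toReal * g i ≤ x - ε →
        ∑' i, p i * ENNReal.ofReal (Real.exp (t * g i)) ≤
          q * ENNReal.ofReal (Real.exp (t * x)) := by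
  set M := max 1 (max |a| |b|) with hM
  have hM1 : 1 ≤ M := le_max_left _ _
  have hM0 : 0 < M := by linarith
  have hM2 : 0 < M ^ 2 := by positivity
  -- `t M ≤ 1` justifies the quadratic bound on `exp`, and `t M² ≤ ε / 2` makes the quadratic
  -- error smaller than half of the linear gain `t ε`.
  set t := min (1 / M) (ε / (2 * M ^ 2)) with ht
  have ht0 : 0 < t := lt_min (by positivity) (by positivity)
  have htM : t * M ≤ 1 := (le_div_iff₀ hM0).1 (min_le_left _ _)
  have htM2 : t * (2 * M ^ 2) ≤ ε := (le_div_iff₀ (by positivity)).1 (min_le_right _ _)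
  refine ⟨t, ht0, ENNReal.ofReal (1 - t * ε / 2), ?_, fun p g x hg hmean => ?_⟩
  · rw [ENNReal.ofReal_lt_one]
    have := mul_pos ht0 hε
    linarith
  have hgM : ∀ i ∈ p.support, |g i - x| ≤ M := fun i hi => by
    rw [abs_le]
    have h1 : |a| ≤ M := (le_max_left _ _).trans (le_max_right _ _)
    have h2 : |b| ≤ M := (le_max_right _ _).trans (le_max_right _ _)
    exact ⟨by linarith [(hg i hi).1, neg_abs_le a], by linarith [(hg i hi).2, le_abs_self b]⟩
  have hexp : ∀ i ∈ p.support, Real.exp (t * g i) ≤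
      Real.exp (t * x) * (1 + t * (g i - x) + t ^ 2 * M ^ 2) := fun i hi => by
    have habs := hgM i hi
    have h1 : |t * (g i - x)| ≤ t * M := by
      rw [abs_mul, abs_of_pos ht0]
      exact mul_le_mul_of_nonneg_left habs ht0.le
    have h2 := (abs_le.1 (Real.abs_exp_sub_one_sub_id_le (h1.trans htM))).2
    have h3 : (t * (g i - x)) ^ 2 ≤ t ^ 2 * M ^ 2 := by
      rw [← mul_pow]
      exact sq_le_sq' (abs_le.1 h1).1 (abs_le.1 h1).2
    have h4 : t * g i = t * x + t * (g i - x) := by ring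
    rw [h4, Real.exp_add]
    exact mul_le_mul_of_nonneg_left (by linarith) (Real.exp_pos _).le
  have hsg : Summable fun i => (p i).toReal * g i :=
    p.summable_toReal_mul (C := M + |x|) fun i hi => by
      have := abs_sub_abs_le_abs_sub (g i) x
      linarith [hgM i hi]
  have hs1 : Summable fun i => (p i).toReal * (1 - t * x + t ^ 2 * M ^ 2) :=
    p.summable_toReal.mul_right _
  have heq (i) : (p i).toReal * (Real.exp (t * x) * (1 + t * (g i - x) + t ^ 2 * M ^ 2)) =
      Real.exp (t * x) * ((p i).toReal * (1 - t * x + t ^ 2 * M ^ 2) +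
        t * ((p i).toReal * g i)) := by ring
  calc ∑' i, p i * ENNReal.ofReal (Real.exp (t * g i))
      ≤ ∑' i, ENNReal.ofReal
          ((p i).toReal * (Real.exp (t * x) * (1 + t * (g i - x) + t ^ 2 * M ^ 2))) := by
        refine ENNReal.tsum_le_tsum fun i => ?_
        by_cases hi : p i = 0
        · simp [hi]
        · rw [ENNReal.ofReal_mul ENNReal.toReal_nonneg, ENNReal.ofReal_toReal (p.apply_ne_top i)]
          exact mul_le_mul_right (ENNReal.ofReal_le_ofReal (hexp i hi)) _
    _ = ENNReal.ofReal (∑' i,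
          (p i).toReal * (Real.exp (t * x) * (1 + t * (g i - x) + t ^ 2 * M ^ 2))) := by
        refine (ENNReal.ofReal_tsum_of_nonneg (fun i => ?_) ?_).symm
        · by_cases hi : p i = 0
          · simp [hi]
          · exact mul_nonneg ENNReal.toReal_nonneg ((Real.exp_pos _).le.trans (hexp i hi))
        · simp_rw [heq]
          exact (hs1.add (hsg.mul_left t)).mul_left _
    _ ≤ ENNReal.ofReal ((1 - t * ε / 2) * Real.exp (t * x)) := by
        refine ENNReal.ofReal_le_ofReal ?_
        simp_rw [heq]
        rw [tsum_mul_left, hs1.tsum_add (hsg.mul_left t), tsum_mul_right, p.tsum_toReal,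
          tsum_mul_left, mul_comm]
        refine mul_le_mul_of_nonneg_right ?_ (Real.exp_pos _).le
        have h1 := mul_le_mul_of_nonneg_left hmean ht0.le
        have h2 := mul_le_mul_of_nonneg_left htM2 ht0.le
        linarith
    _ ≤ ENNReal.ofReal (1 - t * ε / 2) * ENNReal.ofReal (Real.exp (t * x)) := by
        rw [ENNReal.ofReal_mul' (Real.exp_pos _).le]

namespace DSM

theorem tsum_coin_toReal_mul (p : unitInterval) (g : Bool → ℝ) :
    ∑' h, (coin p h).toReal * g h = p * g true + (1 - p) * g false := by
  have h1 : (0 : ℝ) ≤ 1 - p := sub_nonneg.2 p.2.2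
  simp [coin, ENNReal.toReal_ofReal p.2.1, ENNReal.toReal_ofReal h1]

/-- The exponential of a descent supermartingale map contracts in expectation at every step. -/
theorem exists_upper_exp_le {Vr : Type} [Fintype Vr] {ε : ℝ} (hε : 0 < ε) (a b : ℝ) :
    ∃ t : ℝ, 0 < t ∧ ∃ q : ℝ≥0∞, q < 1 ∧ ∀ {S : Ops} {Vp L : Type} (Υ : Vr → PMF ℤ)
      (n : Node S Vp Vr L) (ν : Val Vp) (x : ℝ) (η : L → Val Vp → ℝ),
      n.Descends Υ ε a b ν x η → n.upper Υ ν (fun l μ => ENNReal.ofReal (Real.exp (t * η l μ))) ≤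
        q * ENNReal.ofReal (Real.exp (t * x)) := by
  obtain ⟨t, ht, q, hq, H⟩ := PMF.exists_tsum_exp_le hε a b
  refine ⟨t, ht, q, hq, fun {S Vp L} Υ n ν x η h => ?_⟩
  have hdet (y : ℝ) (hy : a ≤ y - x ∧ y - x ≤ min (-ε) b) :
      ENNReal.ofReal (Real.exp (t * y)) ≤ q * ENNReal.ofReal (Real.exp (t * x)) := by
    have := H (PMF.pure ()) (fun _ => y) x
      (fun _ _ => ⟨hy.1, hy.2.trans (min_le_right _ _)⟩) (by
        rw [tsum_mul_right, PMF.tsum_toReal]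
        linarith [hy.2.trans (min_le_left _ _)])
    rwa [PMF.tsum_pure_mul] at this
  cases n with
  | assign u l => exact H _ _ x h.1 h.2
  | cond φ l₁ l₂ =>
    by_cases hs : φ.Sat ν
    · simp only [Node.upper, if_pos hs]
      exact hdet _ (h.1 hs)
    · simp only [Node.upper, if_neg hs]
      exact hdet _ (h.2 hs)
  | prob p l₁ l₂ =>
    refine H (coin p) (fun b => η (if b then l₁ else l₂) ν) x (fun b _ => ?_) ?_
    · cases b
      · exact h.2.1
      · exact h.1
    · rw [tsum_coin_toReal_mul]
      exact h.2.2
  | nondet l₁ l₂ => exact max_le (hdet _ h.1) (hdet _ h.2)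

/-! ### Termination of composite programs -/

variable {S : Ops} {Vp Vr : Type} [Fintype Vr] [DecidableEq Vp] {Υ : Vr → PMF ℤ}

/-- A subsolution for a program restricts to a subsolution for a subprogram, if it vanishes where
control leaves the subprogram. -/
theorem Subsolution.restrict {P Q : Prog S Vp Vr} {w : Q.Label → Val Vp → ℝ≥0∞}
    (hw : Subsolution Υ Q w) (f : P.Label → Q.Label) (hout : ∀ ν, w (f none) ν = 0)
    (hf : ∀ l, ∃ m, f (some l) = some m ∧ Q.node m = (P.node l).map f) :
    Subsolution Υ P fun l => w (f l) where
  out := hout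
  le_one l ν := hw.le_one _ ν
  le_upper l ν := by
    obtain ⟨m, hm, hn⟩ := hf l
    rw [hm, ← Node.upper_map, ← hn]
    exact hw.le_upper m ν

/-- `Q` is a branching of `P₁` and `P₂` (of any kind): the bijection `e` identifies its labels with
an initial label, whose successors are the initial labels of `P₁` and `P₂`, and the labels of `P₁`
and `P₂`. -/
structure IsBranching (Υ : Vr → PMF ℤ) (Q : Prog S Vp Vr) {P₁ P₂ : Prog S Vp Vr}
    (e : Option (P₁.Loc ⊕ P₂.Loc) ≃ Q.Loc) : Prop where
  entry : Q.entry = e none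
  succ : ∀ {ν l' ν'}, (Q.node (e none)).Succ Υ ν l' ν' →
    l' = some (e (some (Sum.inl P₁.entry))) ∨ l' = some (e (some (Sum.inr P₂.entry)))
  node_inl : ∀ l, Q.node (e (some (Sum.inl l))) =
    (P₁.node l).map (Option.map fun l => e (some (Sum.inl l)))
  node_inr : ∀ l, Q.node (e (some (Sum.inr l))) =
    (P₂.node l).map (Option.map fun l => e (some (Sum.inr l)))
  outerGuard_none : Q.outerGuard (e none) = none
  outerGuard_inl : ∀ l, Q.outerGuard (e (some (Sum.inl l))) = P₁.outerGuard l
  outerGuard_inr : ∀ l, Q.outerGuard (e (some (Sum.inr l))) = P₂.outerGuard l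

theorem isBranching_ite (Υ : Vr → PMF ℤ) (G : BExpr S Vp) (P₁ P₂ : Prog S Vp Vr) :
    IsBranching Υ (.ite G P₁ P₂) (Equiv.refl (Option (P₁.Loc ⊕ P₂.Loc))) where
  entry := rfl
  succ {ν l' ν'} h := by
    obtain ⟨rfl, -⟩ := h
    split_ifs
    · exact .inl rfl
    · exact .inr rfl
  node_inl _ := rfl
  node_inr _ := rfl
  outerGuard_none := rfl
  outerGuard_inl _ := rfl
  outerGuard_inr _ := rfl

theorem isBranching_nondet (Υ : Vr → PMF ℤ) (P₁ P₂ : Prog S Vp Vr) :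
    IsBranching Υ (.nondet P₁ P₂) (Equiv.refl (Option (P₁.Loc ⊕ P₂.Loc))) where
  entry := rfl
  succ {ν l' ν'} h := by
    obtain ⟨rfl | rfl, -⟩ := h
    · exact .inl rfl
    · exact .inr rfl
  node_inl _ := rfl
  node_inr _ := rfl
  outerGuard_none := rfl
  outerGuard_inl _ := rfl
  outerGuard_inr _ := rfl

theorem isBranching_prob (Υ : Vr → PMF ℤ) (p : unitInterval) (P₁ P₂ : Prog S Vp Vr) :
    IsBranching Υ (.prob p P₁ P₂) (Equiv.refl (Option (P₁.Loc ⊕ P₂.Loc))) where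
  entry := rfl
  succ {ν l' ν'} h := by
    obtain ⟨b, -, rfl, -⟩ := h
    cases b
    · exact .inr rfl
    · exact .inl rfl
  node_inl _ := rfl
  node_inr _ := rfl
  outerGuard_none := rfl
  outerGuard_inl _ := rfl
  outerGuard_inr _ := rfl

variable [Fintype Vp] {P Q : Prog S Vp Vr}

theorem terminates_of_node_assign (u : Val Vp → Val Vr → Val Vp)
    (h : P.node P.entry = .assign u none) : Terminates Υ P := by
  refine terminates_iff.2 fun w hw ν => le_antisymm ((hw.le_upper P.entry ν).trans ?_) zero_le
  simp [h, Node.upper, hw.out]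

theorem Terminates.seq (hP : Terminates Υ P) (hQ : Terminates Υ Q) :
    Terminates Υ (.seq P Q) := by
  rw [terminates_iff] at hP hQ ⊢
  intro w hw ν
  have h (ν) : w (some (Sum.inr Q.entry)) ν = 0 :=
    hQ _ (hw.restrict (P := Q) (Option.map Sum.inr) hw.out fun l => ⟨Sum.inr l, rfl, rfl⟩) ν
  exact hP _ (hw.restrict (P := P) (fun
    | some l' => some (Sum.inl l')
    | none => some (Sum.inr Q.entry)) h fun l => ⟨Sum.inl l, rfl, rfl⟩) ν

theorem Terminates.branch {P₁ P₂ : Prog S Vp Vr} {e : Option (P₁.Loc ⊕ P₂.Loc) ≃ Q.Loc}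
    (hQ : IsBranching Υ Q e) (h₁ : Terminates Υ P₁) (h₂ : Terminates Υ P₂) :
    Terminates Υ Q := by
  rw [terminates_iff] at h₁ h₂ ⊢
  intro w hw ν
  have h₁' := h₁ _ (hw.restrict (P := P₁) (Option.map fun l => e (some (Sum.inl l))) hw.out
    fun l => ⟨_, rfl, hQ.node_inl l⟩)
  have h₂' := h₂ _ (hw.restrict (P := P₂) (Option.map fun l => e (some (Sum.inr l))) hw.out
    fun l => ⟨_, rfl, hQ.node_inr l⟩)
  rw [Prog.lin, hQ.entry]
  refine le_antisymm ((hw.le_upper (e none) ν).trans ?_) zero_le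
  -- The zero function, written as a multiple, so that `Node.upper_const_mul` evaluates it.
  refine (Node.upper_mono _ (w' := fun _ _ => 0 * 0) fun l' ν' hs => ?_).trans
    ((Node.upper_const_mul _ _ _).trans (zero_mul _)).le
  rcases hQ.succ hs with rfl | rfl
  · exact (h₁' ν').trans_le zero_le
  · exact (h₂' ν').trans_le zero_le

/-- The labels of the body of a loop, as labels of the loop: control returns from the terminal
label of the body to the label of the loop. -/
def whileEmb (G : BExpr S Vp) (P : Prog S Vp Vr) : P.Label → (Prog.while G P).Label
  | some l => some (some l)
  | none => some none

/-- If the body of a loop terminates and the loop has a descent supermartingale map, then the loop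
terminates. With `f = exp (t η)`, a subsolution `w` of the loop satisfies `w ≤ K f` at the label
of the loop, because `η ≥ c` there. If `w ≤ θ f` there, then `w - θ f`, on the reachable
configurations, is a subsolution of the body, so that `w ≤ θ f` also at the entry of the body,
and the contraction of `f` improves the bound at the label of the loop to `w ≤ q θ f`. -/
theorem Terminates.while {G : BExpr S Vp} (hP : Terminates Υ P) {ε c a b : ℝ} (hε : 0 < ε)
    {I : (Prog.while G P).Label → Set (Val Vp)} {η : (Prog.while G P).Label → Val Vp → ℝ}
    (hI : IsInvariant Υ (.while G P) I) (hη : IsDSM Υ (.while G P) ε c a b I η) :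
    Terminates Υ (.while G P) := by
  classical
  rw [terminates_iff] at hP ⊢
  intro w hw ν₀
  obtain ⟨t, ht, q, hq, hf⟩ := exists_upper_exp_le (Vr := Vr) hε a b
  have hdesc (l) (ν) (h : Reachable Υ (Prog.while G P) ⟨some l, ν⟩) :=
    hf Υ _ ν _ η (isPartialDSM_iff.1 hη.toIsPartialDSM l ν (hI _ h))
  set f : (Prog.while G P).Label → Val Vp → ℝ≥0∞ :=
    fun l ν => ENNReal.ofReal (Real.exp (t * η l ν)) with hf_def
  set K := ENNReal.ofReal (Real.exp (-(t * c))) with hK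
  have hstart (ν) : Reachable Υ (Prog.while G P) ⟨some none, ν⟩ := .start ν
  have hw_sat (ν) (hν : G.Sat ν) : w (some none) ν ≤ w (some (some P.entry)) ν := by
    simpa only [Prog.node, Node.upper, if_pos hν] using hw.le_upper none ν
  have hw_not (ν) (hν : ¬ G.Sat ν) : w (some none) ν = 0 := by
    simpa only [Prog.node, Node.upper, if_neg hν, hw.out, nonpos_iff_eq_zero] using
      hw.le_upper none ν
  have hf_sat (ν) (hν : G.Sat ν) : f (some (some P.entry)) ν ≤ q * f (some none) ν := by
    simpa only [Prog.node, Node.upper, if_pos hν] using hdesc none ν (hstart ν)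
  have main (k : ℕ) (ν) : w (some none) ν ≤ q ^ k * K * f (some none) ν := by
    induction k generalizing ν with
    | zero =>
      by_cases hν : G.Sat ν
      · refine (hw.le_one _ _).trans ?_
        have hc : c ≤ η (some none) ν := hη.lower_bound none G rfl ν (hI _ (hstart ν)) hν
        rw [pow_zero, one_mul, hK, hf_def, ← ENNReal.ofReal_mul (Real.exp_pos _).le,
          ← Real.exp_add, ENNReal.one_le_ofReal, Real.one_le_exp_iff]
        linarith [mul_le_mul_of_nonneg_left hc ht.le]
      · simp [hw_not ν hν]
    | succ k ih =>
      by_cases hν : G.Sat ν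
      swap
      · simp [hw_not ν hν]
      set θ := q ^ k * K
      let w' (l : P.Label) (ν : Val Vp) : ℝ≥0∞ :=
        if Reachable Υ (Prog.while G P) ⟨whileEmb G P l, ν⟩ then
          w (whileEmb G P l) ν - θ * f (whileEmb G P l) ν else 0
      have hw' {l ν} (h : Reachable Υ (Prog.while G P) ⟨whileEmb G P l, ν⟩) :
          w' l ν = w (whileEmb G P l) ν - θ * f (whileEmb G P l) ν := if_pos h
      have hsub : Subsolution Υ P w' := by
        refine ⟨fun ν => ?_, fun l ν => ?_, fun l ν => ?_⟩
        · exact (hw' (l := none) (hstart ν)).trans (tsub_eq_zero_of_le (ih ν))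
        · simp only [w']
          split_ifs
          · exact tsub_le_self.trans (hw.le_one _ ν)
          · exact zero_le
        by_cases hr : Reachable Υ (Prog.while G P) ⟨whileEmb G P (some l), ν⟩
        swap
        · simp only [w', if_neg hr, zero_le]
        have hnode : (Prog.while G P).node (some l) = (P.node l).map (whileEmb G P) := rfl
        have hup := hw.le_upper (some l) ν
        have hfl : (P.node l).upper Υ ν (fun l => f (whileEmb G P l)) ≤ f (some (some l)) ν := by
          rw [← Node.upper_map, ← hnode]
          exact (hdesc (some l) ν hr).trans (mul_le_of_le_one_left zero_le hq.le)
        rw [hw' hr, tsub_le_iff_right]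
        refine hup.trans ?_
        rw [hnode, Node.upper_map]
        refine (Node.upper_mono _ (w' := fun l ν => w' l ν + θ * f (whileEmb G P l) ν)
          fun l' ν' hs => ?_).trans ((Node.upper_add_le _ _ _).trans
            (add_le_add_right ?_ _))
        · have hr' : Reachable Υ (Prog.while G P) ⟨whileEmb G P l', ν'⟩ :=
            Reachable.succ hr (hnode ▸ (Node.succ_map _ _).2 ⟨l', rfl, hs⟩)
          rw [hw' hr']
          exact le_tsub_add
        · rw [Node.upper_const_mul]
          exact mul_le_mul_right hfl θ
      have hr : Reachable Υ (Prog.while G P) ⟨some (some P.entry), ν⟩ := by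
        refine Reachable.succ (hstart ν) ?_
        simp only [Prog.node, Node.Succ, if_pos hν, and_self]
      have h0 : w (some (some P.entry)) ν - θ * f (some (some P.entry)) ν = 0 :=
        (hw' (l := P.lin) hr).symm.trans (hP _ hsub ν)
      calc w (some none) ν ≤ w (some (some P.entry)) ν := hw_sat ν hν
        _ ≤ θ * f (some (some P.entry)) ν := tsub_eq_zero_iff_le.1 h0
        _ ≤ θ * (q * f (some none) ν) := mul_le_mul_right (hf_sat ν hν) θ
        _ = q ^ (k + 1) * K * f (some none) ν := by simp only [θ]; ring
  have hlim : Filter.Tendsto (fun k : ℕ => q ^ k * (K * f (some none) ν₀)) .atTop (nhds 0) := by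
    have := ENNReal.Tendsto.mul_const (b := K * f (some none) ν₀)
      (ENNReal.tendsto_pow_atTop_nhds_zero_of_lt_one hq)
      (.inr (ENNReal.mul_ne_top ENNReal.ofReal_ne_top ENNReal.ofReal_ne_top))
    rwa [zero_mul] at this
  refine le_antisymm (ge_of_tendsto' hlim fun k => ?_) zero_le
  rw [← mul_assoc]
  exact main k ν₀

end DSM

namespace DSM

/-! ### Soundness of the rules for triples -/

theorem Expr.eval_bind {S : Ops} {V W : Type} (f : V → Expr S W) (ν : Val W) (e : Expr S V) :
    (e.bind f).eval ν = e.eval fun x => (f x).eval ν := by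
  induction e with
  | const k => rfl
  | var x => rfl
  | op o args ih => simp only [Expr.bind, Expr.eval, ih]

theorem RExpr.eval_bind {S : Ops} {V W : Type} (f : V → Expr S W) (ν : Val W) (R : RExpr S V) :
    (R.bind f).eval ν = R.eval fun x => (f x).eval ν := by
  induction R with
  | const r => rfl
  | int e => simp only [RExpr.bind, RExpr.eval, Expr.eval_bind]
  | op o args ih => simp only [RExpr.bind, RExpr.eval, ih]


theorem RExpr.eval_subst {S : Ops} {Vp Vr : Type} [DecidableEq Vp] (R : RExpr S Vp) (x : Vp) (e : Expr S (Vp ⊕ Vr)) (ν : Val Vp)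
    (μ : Val Vr) : (R.subst x e).eval (Sum.elim ν μ) =
      R.eval (Function.update ν x (e.eval (Sum.elim ν μ))) := by
  rw [RExpr.subst, RExpr.eval_bind]
  congr 1
  funext y
  by_cases h : y = x
  · subst h
    simp
  · simp [h, Expr.eval]

theorem eventually_bound {ε : ℝ} (hε : 0 < ε) (a b : ℝ) :
    ∀ᶠ M : ℝ in .atTop, 0 < M ∧ M⁻¹ ≤ ε ∧ -M ≤ a ∧ b ≤ M := by
  filter_upwards [Filter.eventually_gt_atTop 0, tendsto_inv_atTop_zero.eventually_le_const hε,
    Filter.eventually_ge_atTop (-a), Filter.eventually_ge_atTop b] with M h0 h1 h2 h3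
  exact ⟨h0, h1, by linarith, h3⟩

/-- For `M` large enough, the bounds of `Drop a ε` imply those of a DSM with parameter `M`. -/
theorem eventually_drop {S : Ops} {Vp : Type} {ε : ℝ} (hε : 0 < ε) (a : ℝ) :
    ∀ᶠ M : ℝ in .atTop, ∀ (R R' : RExpr S Vp) (ν : Val Vp), Drop a ε R R' ν →
      -M ≤ R'.eval ν - R.eval ν ∧ R'.eval ν - R.eval ν ≤ min (-M⁻¹) M := by
  filter_upwards [eventually_bound hε a 0] with M ⟨h0, h1, h2, h3⟩ R R' ν hR
  exact ⟨h2.trans hR.1, le_min (by linarith [hR.2]) (by linarith [hR.2])⟩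

variable {S : Ops} {Vp Vr : Type} [Fintype Vr] [DecidableEq Vp] {Υ : Vr → PMF ℤ}

/-- The conditions of a DSM (`k = .full`) or partial DSM (`k = .part`) at one configuration with a
non-terminal label, with the parameters `ε = M⁻¹`, `a = c = -M` and `b = M`. For `M > 0`, the
conditions weaken as `M` increases. -/
def DescendsAt (Υ : Vr → PMF ℤ) (k : Kind) (P : Prog S Vp Vr) (η : P.Label → Val Vp → ℝ) (M : ℝ)
    (l : P.Loc) (ν : Val Vp) : Prop :=
  (P.node l).Descends Υ M⁻¹ (-M) M ν (η (some l) ν) η ∧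
    (k = .full → ∀ G, P.outerGuard l = some G → G.Sat ν → -M ≤ η (some l) ν)

theorem DescendsAt.embed {k k' : Kind} {P Q : Prog S Vp Vr} {η : P.Label → Val Vp → ℝ}
    {η' : Q.Label → Val Vp → ℝ} {M : ℝ} {l : P.Loc} {m : Q.Loc} {ν : Val Vp}
    (h : DescendsAt Υ k P η M l ν) (f : P.Label → Q.Label) (hm : f (some l) = some m)
    (hn : Q.node m = (P.node l).map f) (hη : (fun l => η' (f l)) = η)
    (hg : k' = .full → ∀ G, Q.outerGuard m = some G → k = .full ∧ P.outerGuard l = some G) :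
    DescendsAt Υ k' Q η' M m ν := by
  subst hη
  refine ⟨?_, fun hk G hG hν => ?_⟩
  · rw [hn, Node.descends_map, ← hm]
    exact h.1
  · rw [← hm]
    exact h.2 (hg hk G hG).1 G (hg hk G hG).2 hν

variable [Fintype Vp]

/-- Triples, with all parameters replaced by one bound `M`, which may be increased, and with the
reachable configurations as the invariant. -/
theorem valid_triple_iff {k : Kind} {R R' : RExpr S Vp} {P : Prog S Vp Vr} :
    (Judgment.triple k R P R').Valid Υ ↔ ∃ η : P.Label → Val Vp → ℝ,
      (∀ ν, η P.lin ν = R.eval ν) ∧ (∀ ν, η P.lout ν = R'.eval ν) ∧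
      ∀ᶠ M in .atTop, ∀ l ν, Reachable Υ P ⟨some l, ν⟩ → DescendsAt Υ k P η M l ν := by
  constructor
  · intro h
    cases k with
    | full =>
      obtain ⟨ε, c, a, b, hε, -, I, η, hI, hη, h1, h2⟩ := h
      refine ⟨η, h1, h2, ?_⟩
      filter_upwards [eventually_bound hε a b, Filter.eventually_ge_atTop (-c)]
        with M ⟨_, hM1, hM2, hM3⟩ hM4 l ν hr
      refine ⟨(isPartialDSM_iff.1 hη.1 l ν (hI _ hr)).mono hM1 hM2 hM3, fun _ G hG hν => ?_⟩
      linarith [hη.2 l G hG ν (hI _ hr) hν]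
    | part =>
      obtain ⟨ε, a, b, hε, -, I, η, hI, hη, h1, h2⟩ := h
      refine ⟨η, h1, h2, ?_⟩
      filter_upwards [eventually_bound hε a b] with M ⟨_, hM1, hM2, hM3⟩ l ν hr
      exact ⟨(isPartialDSM_iff.1 hη l ν (hI _ hr)).mono hM1 hM2 hM3, fun h => nomatch h⟩
  · rintro ⟨η, h1, h2, h3⟩
    obtain ⟨M, hM, hM0⟩ := (h3.and (Filter.eventually_gt_atTop 0)).exists
    have hη : IsPartialDSM Υ P M⁻¹ (-M) M (fun l => {ν | Reachable Υ P ⟨l, ν⟩}) η :=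
      isPartialDSM_iff.2 fun l ν hr => (hM l ν hr).1
    cases k with
    | full =>
      exact ⟨M⁻¹, -M, -M, M, inv_pos.2 hM0, by linarith, _, η, fun c hc => hc,
        ⟨hη, fun l G hG ν hr => (hM l ν hr).2 rfl G hG⟩, h1, h2⟩
    | part => exact ⟨M⁻¹, -M, M, inv_pos.2 hM0, by linarith, _, η, fun c hc => hc, hη, h1, h2⟩

variable {k : Kind} {R R' R'' R₁ R₂ : RExpr S Vp} {P P₁ P₂ Q : Prog S Vp Vr}

theorem valid_skip {a ε : ℝ} (hε : 0 < ε) (h : ∀ ν, Drop a ε R R' ν) :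
    (Judgment.triple k R .skip R').Valid Υ := by
  refine valid_triple_iff.2 ⟨fun l ν => l.elim (R'.eval ν) fun _ => R.eval ν, fun _ => rfl,
    fun _ => rfl, ?_⟩
  filter_upwards [eventually_drop hε a] with M hM l ν _
  refine ⟨⟨fun μ _ => ⟨(hM _ _ ν (h ν)).1, (hM _ _ ν (h ν)).2.trans (min_le_right _ _)⟩, ?_⟩,
    fun _ _ hG => nomatch hG⟩
  rw [tsum_mul_right, PMF.tsum_toReal, one_mul]
  have := (hM _ _ ν (h ν)).2.trans (min_le_left _ _)
  simp only [Option.elim] at this ⊢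
  linarith

theorem valid_assign {x : Vp} {e : Expr S (Vp ⊕ Vr)} {a b ε : ℝ} (hε : 0 < ε)
    (hab : ∀ ν, ∀ μ ∈ (joint Υ).support,
      a ≤ (R'.subst x e).eval (Sum.elim ν μ) - R.eval ν ∧
      (R'.subst x e).eval (Sum.elim ν μ) - R.eval ν ≤ b)
    (he : ∀ ν, (R'.subst x e).expect Υ ν - R.eval ν ≤ -ε) :
    (Judgment.triple k R (.assign x e) R').Valid Υ := by
  refine valid_triple_iff.2 ⟨fun l ν => l.elim (R'.eval ν) fun _ => R.eval ν, fun _ => rfl,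
    fun _ => rfl, ?_⟩
  simp only [RExpr.expect, RExpr.eval_subst] at hab he
  filter_upwards [eventually_bound hε a b] with M ⟨_, hM1, hM2, hM3⟩ l ν _
  refine ⟨⟨fun μ hμ => ⟨hM2.trans (hab ν μ hμ).1, (hab ν μ hμ).2.trans hM3⟩, ?_⟩,
    fun _ _ hG => nomatch hG⟩
  have := he ν
  simp only [Option.elim] at this ⊢
  linarith

theorem valid_seq (h₁ : (Judgment.triple k R P₁ R').Valid Υ)
    (h₂ : (Judgment.triple k R' P₂ R'').Valid Υ) :
    (Judgment.triple k R (.seq P₁ P₂) R'').Valid Υ := by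
  obtain ⟨η₁, hin₁, hout₁, hη₁⟩ := valid_triple_iff.1 h₁
  obtain ⟨η₂, hin₂, hout₂, hη₂⟩ := valid_triple_iff.1 h₂
  refine valid_triple_iff.2 ⟨fun l => l.elim (η₂ none)
    (Sum.elim (fun l => η₁ (some l)) fun l => η₂ (some l)), hin₁, hout₂, ?_⟩
  have hreach {l : P₁.Loc ⊕ P₂.Loc} {ν} (h : Reachable Υ (Prog.seq P₁ P₂) ⟨some l, ν⟩) :
      Sum.elim (fun l => Reachable Υ P₁ ⟨some l, ν⟩) (fun l => Reachable Υ P₂ ⟨some l, ν⟩) l := by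
    refine h.loc_induction (P := .seq P₁ P₂) (C := fun l ν => Sum.elim
      (fun l => Reachable Υ P₁ ⟨some l, ν⟩) (fun l => Reachable Υ P₂ ⟨some l, ν⟩) l)
      Reachable.start ?_
    rintro (l | l) ν l' ν' hl hs <;>
      obtain ⟨_ | m, hm, hs'⟩ := (Node.succ_map _ _).1 hs <;> cases hm
    · exact .start ν'
    · exact hl.succ hs'
    · exact hl.succ hs'
  filter_upwards [hη₁, hη₂] with M hM₁ hM₂
  rintro (l | l) ν hr
  · refine (hM₁ l ν (hreach hr)).embed (fun
      | some l' => some (Sum.inl l')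
      | none => some (Sum.inr P₂.entry)) rfl rfl ?_ fun hk _ hG => ⟨hk, hG⟩
    funext l' ν'
    cases l' with
    | none => exact (hin₂ ν').trans (hout₁ ν').symm
    | some l' => rfl
  · refine (hM₂ l ν (hreach hr)).embed (Option.map Sum.inr) rfl rfl ?_ fun hk _ hG => ⟨hk, hG⟩
    funext l'
    cases l' <;> rfl

/-- The common part of the rules for the three kinds of branching: it remains to check the
conditions at the initial label, for an `η` with the values `R₁` and `R₂` at its successors. -/
theorem valid_branch {e : Option (P₁.Loc ⊕ P₂.Loc) ≃ Q.Loc} (hQ : IsBranching Υ Q e)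
    (h₁ : (Judgment.triple k R₁ P₁ R').Valid Υ) (h₂ : (Judgment.triple k R₂ P₂ R').Valid Υ)
    (h : ∀ η : Q.Label → Val Vp → ℝ,
      (∀ ν, η (some (e (some (Sum.inl P₁.entry)))) ν = R₁.eval ν) →
      (∀ ν, η (some (e (some (Sum.inr P₂.entry)))) ν = R₂.eval ν) →
      ∀ᶠ M : ℝ in .atTop, ∀ ν, (Q.node (e none)).Descends Υ M⁻¹ (-M) M ν (R.eval ν) η) :
    (Judgment.triple k R Q R').Valid Υ := by
  obtain ⟨η₁, hin₁, hout₁, hη₁⟩ := valid_triple_iff.1 h₁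
  obtain ⟨η₂, hin₂, hout₂, hη₂⟩ := valid_triple_iff.1 h₂
  let η (l : Q.Label) : Val Vp → ℝ := l.elim (fun ν => R'.eval ν) fun m => (e.symm m).elim
    (fun ν => R.eval ν) (Sum.elim (fun l => η₁ (some l)) fun l => η₂ (some l))
  have hη_none : η (some (e none)) = fun ν => R.eval ν := by simp [η]
  have hη_inl (l) : η (some (e (some (Sum.inl l)))) = η₁ (some l) := by simp [η]
  have hη_inr (l) : η (some (e (some (Sum.inr l)))) = η₂ (some l) := by simp [η]
  have hη_map₁ : (fun l => η (Option.map (fun l => e (some (Sum.inl l))) l)) = η₁ := by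
    funext l ν
    cases l with
    | none => exact (hout₁ ν).symm
    | some l => exact congrFun (hη_inl l) ν
  have hη_map₂ : (fun l => η (Option.map (fun l => e (some (Sum.inr l))) l)) = η₂ := by
    funext l ν
    cases l with
    | none => exact (hout₂ ν).symm
    | some l => exact congrFun (hη_inr l) ν
  refine valid_triple_iff.2 ⟨η, fun ν => ?_, fun _ => rfl, ?_⟩
  · rw [Prog.lin, hQ.entry, hη_none]
  let C (m : Q.Loc) (ν : Val Vp) : Prop := (e.symm m).elim True
    (Sum.elim (fun l => Reachable Υ P₁ ⟨some l, ν⟩) fun l => Reachable Υ P₂ ⟨some l, ν⟩)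
  have hreach {m : Q.Loc} {ν} (hr : Reachable Υ Q ⟨some m, ν⟩) : C m ν := by
    refine hr.loc_induction (fun ν => by simp [C, hQ.entry]) fun m ν m' ν' hm hs => ?_
    obtain ⟨l, rfl⟩ := e.surjective m
    rcases l with _ | l | l
    · rcases hQ.succ hs with h | h <;> obtain rfl := Option.some.inj h
      · simpa [C, Prog.lin] using Reachable.start (P := P₁) ν'
      · simpa [C, Prog.lin] using Reachable.start (P := P₂) ν'
    · rw [hQ.node_inl] at hs
      obtain ⟨_ | l', hl', hs'⟩ := (Node.succ_map _ _).1 hs <;> cases hl'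
      simp only [C, Equiv.symm_apply_apply, Option.elim, Sum.elim_inl] at hm ⊢
      exact hm.succ hs'
    · rw [hQ.node_inr] at hs
      obtain ⟨_ | l', hl', hs'⟩ := (Node.succ_map _ _).1 hs <;> cases hl'
      simp only [C, Equiv.symm_apply_apply, Option.elim, Sum.elim_inr] at hm ⊢
      exact hm.succ hs'
  filter_upwards [hη₁, hη₂, h η (fun ν => (congrFun (hη_inl _) ν).trans (hin₁ ν))
    fun ν => (congrFun (hη_inr _) ν).trans (hin₂ ν)] with M hM₁ hM₂ hM m ν hr
  have hC := hreach hr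
  obtain ⟨l, rfl⟩ := e.surjective m
  rcases l with _ | l | l
  · refine ⟨?_, fun _ G hG => ?_⟩
    · rw [hη_none]
      exact hM ν
    · rw [hQ.outerGuard_none] at hG
      cases hG
  · simp only [C, Equiv.symm_apply_apply, Option.elim, Sum.elim_inl] at hC
    exact (hM₁ l ν hC).embed _ rfl (hQ.node_inl l) hη_map₁
      fun hk G hG => ⟨hk, hQ.outerGuard_inl l ▸ hG⟩
  · simp only [C, Equiv.symm_apply_apply, Option.elim, Sum.elim_inr] at hC
    exact (hM₂ l ν hC).embed _ rfl (hQ.node_inr l) hη_map₂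
      fun hk G hG => ⟨hk, hQ.outerGuard_inr l ▸ hG⟩

theorem valid_ite {G : BExpr S Vp} {a ε : ℝ} (hε : 0 < ε)
    (hG : ∀ ν, G.Sat ν → Drop a ε R R₁ ν) (hG' : ∀ ν, ¬ G.Sat ν → Drop a ε R R₂ ν)
    (h₁ : (Judgment.triple k R₁ P₁ R').Valid Υ) (h₂ : (Judgment.triple k R₂ P₂ R').Valid Υ) :
    (Judgment.triple k R (.ite G P₁ P₂) R').Valid Υ := by
  refine valid_branch (isBranching_ite Υ G P₁ P₂) h₁ h₂ fun η hη₁ hη₂ => ?_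
  filter_upwards [eventually_drop hε a] with M hM ν
  refine ⟨fun hν => ?_, fun hν => ?_⟩
  · have := hM _ _ ν (hG ν hν)
    rwa [← hη₁] at this
  · have := hM _ _ ν (hG' ν hν)
    rwa [← hη₂] at this

theorem valid_nondet {a ε : ℝ} (hε : 0 < ε)
    (hR₁ : ∀ ν, Drop a ε R R₁ ν) (hR₂ : ∀ ν, Drop a ε R R₂ ν)
    (h₁ : (Judgment.triple k R₁ P₁ R').Valid Υ) (h₂ : (Judgment.triple k R₂ P₂ R').Valid Υ) :
    (Judgment.triple k R (.nondet P₁ P₂) R').Valid Υ := by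
  refine valid_branch (isBranching_nondet Υ P₁ P₂) h₁ h₂ fun η hη₁ hη₂ => ?_
  filter_upwards [eventually_drop hε a] with M hM ν
  refine ⟨?_, ?_⟩
  · have := hM _ _ ν (hR₁ ν)
    rwa [← hη₁] at this
  · have := hM _ _ ν (hR₂ ν)
    rwa [← hη₂] at this

theorem valid_prob {p : unitInterval} {a b ε : ℝ} (hε : 0 < ε)
    (hR₁ : ∀ ν, a ≤ R₁.eval ν - R.eval ν ∧ R₁.eval ν - R.eval ν ≤ b)
    (hR₂ : ∀ ν, a ≤ R₂.eval ν - R.eval ν ∧ R₂.eval ν - R.eval ν ≤ b)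
    (hR : ∀ ν, (p : ℝ) * R₁.eval ν + (1 - p) * R₂.eval ν ≤ R.eval ν - ε)
    (h₁ : (Judgment.triple k R₁ P₁ R').Valid Υ) (h₂ : (Judgment.triple k R₂ P₂ R').Valid Υ) :
    (Judgment.triple k R (.prob p P₁ P₂) R').Valid Υ := by
  refine valid_branch (isBranching_prob Υ p P₁ P₂) h₁ h₂ fun η hη₁ hη₂ => ?_
  filter_upwards [eventually_bound hε a b] with M ⟨_, hM1, hM2, hM3⟩ ν
  refine ⟨?_, ?_, ?_⟩
  · have := hR₁ ν
    rw [← hη₁] at this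
    exact ⟨hM2.trans this.1, this.2.trans hM3⟩
  · have := hR₂ ν
    rw [← hη₂] at this
    exact ⟨hM2.trans this.1, this.2.trans hM3⟩
  · have := hR ν
    rw [← hη₁, ← hη₂] at this
    exact this.trans (sub_le_sub_left hM1 _)

theorem valid_while {G : BExpr S Vp} {a ε : ℝ} (hε : 0 < ε)
    (hc : k = .full → ∃ c, ∀ ν, G.Sat ν → c ≤ R'.eval ν)
    (hG : ∀ ν, G.Sat ν → Drop a ε R' R ν) (hG' : ∀ ν, ¬ G.Sat ν → Drop a ε R' R'' ν)
    (h : (Judgment.triple .part R P R').Valid Υ) :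
    (Judgment.triple k R' (.while G P) R'').Valid Υ := by
  obtain ⟨η₁, hin, hout, hη₁⟩ := valid_triple_iff.1 h
  refine valid_triple_iff.2 ⟨fun l => l.elim (fun ν => R''.eval ν) fun l => η₁ l, hout,
    fun _ => rfl, ?_⟩
  have hreach {l : Option P.Loc} {ν} (h : Reachable Υ (Prog.while G P) ⟨some l, ν⟩) :
      l.elim True fun l => Reachable Υ P ⟨some l, ν⟩ := by
    refine h.loc_induction (P := .while G P)
      (C := fun l ν => Option.elim l True fun l => Reachable Υ P ⟨some l, ν⟩)
      (fun _ => trivial) ?_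
    rintro (_ | l) ν (_ | l') ν' hl hs
    · trivial
    · obtain ⟨hl', rfl⟩ := hs
      split_ifs at hl'
      obtain rfl := Option.some.inj (Option.some.inj hl')
      exact .start ν
    · trivial
    · obtain ⟨_ | m, hm, hs'⟩ := (Node.succ_map _ _).1 hs <;> cases hm
      exact hl.succ hs'
  have hc' : ∀ᶠ M : ℝ in .atTop, k = .full → ∀ ν, G.Sat ν → -M ≤ R'.eval ν := by
    by_cases hk : k = .full
    · obtain ⟨c, hc⟩ := hc hk
      filter_upwards [Filter.eventually_ge_atTop (-c)] with M hM _ ν hν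
      linarith [hc ν hν]
    · exact .of_forall fun M h => absurd h hk
  filter_upwards [hη₁, hc', eventually_drop hε a] with M hM₁ hMc hM
  rintro (_ | l) ν hr
  · refine ⟨⟨fun hν => ?_, fun hν => ?_⟩, fun hk G' hG' hν => ?_⟩
    · have := hM _ _ ν (hG ν hν)
      rwa [← hin, ← hout] at this
    · have := hM _ _ ν (hG' ν hν)
      rwa [← hout] at this
    · obtain rfl : G = G' := Option.some.inj hG'
      exact (hMc hk ν hν).trans_eq (hout ν).symm
  · refine (hM₁ l ν (hreach hr)).embed (whileEmb G P) rfl rfl ?_ fun _ _ hG => nomatch hG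
    funext l'
    cases l' <;> rfl

end DSM

namespace DSM

/-! ### Soundness of the proof system -/

variable {S : Ops} {Vp Vr : Type} [Fintype Vp] [DecidableEq Vp] [Fintype Vr] {Υ : Vr → PMF ℤ}

theorem Rule.sound {Γ : List (Judgment S Vp Vr)} {J : Judgment S Vp Vr} (h : Rule Υ Γ J)
    (hΓ : ∀ K ∈ Γ, K.Valid Υ) : J.Valid Υ := by
  cases h with
  | while_full R R' R'' G P a c ε hε hc hG hG' =>
    exact valid_while hε (fun _ => ⟨c, hc⟩) hG hG' (hΓ _ (by simp))
  | while_part R R' R'' G P a ε hε hG hG' =>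
    exact valid_while hε (fun h => nomatch h) hG hG' (hΓ _ (by simp))
  | skip k R R' a ε hε h => exact valid_skip hε h
  | assign k R R' x e a b ε hε hab he => exact valid_assign hε hab he
  | seq k R R' R'' P₁ P₂ => exact valid_seq (R' := R') (hΓ _ (by simp)) (hΓ _ (by simp))
  | ite k R R₁ R₂ R' G P₁ P₂ a ε hε hG hG' =>
    exact valid_ite hε hG hG' (hΓ _ (by simp)) (hΓ _ (by simp))
  | nondet k R R₁ R₂ R' P₁ P₂ a ε hε hR₁ hR₂ =>
    exact valid_nondet hε hR₁ hR₂ (hΓ _ (by simp)) (hΓ _ (by simp))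
  | prob k R R₁ R₂ R' p P₁ P₂ a b ε hε hR₁ hR₂ hR =>
    exact valid_prob hε hR₁ hR₂ hR (hΓ _ (by simp)) (hΓ _ (by simp))
  | tm_while R₁ R₂ G P =>
    have hP : Terminates Υ P := hΓ (.tm P) (by simp)
    obtain ⟨ε, c, a, b, hε, -, I, η, hI, hη, -⟩ :=
      hΓ (.triple .full R₁ (.while G P) R₂) (by simp)
    exact hP.while hε hI hη
  | tm_assign x e => exact terminates_of_node_assign _ rfl
  | tm_skip => exact terminates_of_node_assign _ rfl
  | tm_seq P₁ P₂ =>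
    exact Terminates.seq (hΓ (.tm P₁) (by simp)) (hΓ (.tm P₂) (by simp))
  | tm_ite G P₁ P₂ =>
    exact Terminates.branch (isBranching_ite Υ G P₁ P₂) (hΓ (.tm P₁) (by simp))
      (hΓ (.tm P₂) (by simp))
  | tm_nondet P₁ P₂ =>
    exact Terminates.branch (isBranching_nondet Υ P₁ P₂) (hΓ (.tm P₁) (by simp))
      (hΓ (.tm P₂) (by simp))
  | tm_prob p P₁ P₂ =>
    exact Terminates.branch (isBranching_prob Υ p P₁ P₂) (hΓ (.tm P₁) (by simp))
      (hΓ (.tm P₂) (by simp))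

theorem Derivable.sound {J : Judgment S Vp Vr} (h : Derivable Υ J) : J.Valid Υ := by
  induction h with
  | rule Γ J hJ _ ih => exact hJ.sound ih

end DSM

theorem mainTheorem4 (S : DSM.Ops) (Vp Vr : Type) [Fintype Vp] [DecidableEq Vp] [Fintype Vr]
    (Υ : Vr → PMF ℤ) :
    (∀ (Γ : List (DSM.Judgment S Vp Vr)) (J : DSM.Judgment S Vp Vr),
        DSM.Rule Υ Γ J → (∀ K ∈ Γ, K.Valid Υ) → J.Valid Υ) ∧
    (∀ J : DSM.Judgment S Vp Vr, DSM.Derivable Υ J → J.Valid Υ) ∧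
    (∀ P : DSM.Prog S Vp Vr, DSM.Derivable Υ (.tm P) → DSM.Terminates Υ P) :=
  ⟨fun _ _ hJ hΓ => hJ.sound hΓ, fun _ hJ => hJ.sound, fun _ hP => hP.sound⟩
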